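/- Let $r>1$ and $\alpha\in(0,1)$, and put $\beta_1=\frac{1-\alpha+\alpha r}{1-\alpha+r}$ and $C(r)=\frac{1}{2^r(1+r)}$. Let $\lambda$ be Lebesgue measure on $\mathbb R$. **Source.** Let $\mu=g\lambda$ be a probability measure with $\int|x|^{r+\delta}\,d\mu(x)<\infty$ for some $\delta>0$, whose density $g\ge 0$ is *weakly unimodal*: $g$ is continuous on $\operatorname{supp}(\mu)$ and there is $l_0>0$ such that $\{x: g(x)\ge l\}$ is a compact interval for every $l\in(0,l_0)$. **Quantizers.** A *quantizer* is a Borel map $q:\mathbb R\to\mathbb R$ with countable range such that for every $a\in q(\mathbb R)$ the cell $q^{-1}(a)$ is an interval containing $a$ in its interior. Write $$H^\alpha_\mu(q)=\frac{1}{1-\alpha}\log\sum_{a\in q(\mathbb R)}\mu(q^{-1}(a))^\alpha\in[0,\infty],\qquad D_\mu(q)=\int|x-q(x)|^r\,d\mu(x),$$ and $D^\alpha_\mu(R)=\inf\{D_\mu(q): q \text{ a quantizer},\ H^\alpha_\mu(q)\le R\}$. A sequence $(q_n)$ of quantizers is *asymptotically optimal* for $\mu$ if $H^\alpha_\mu(q_n)\to\infty$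 and $D_\mu(q_n)/D^\alpha_\mu(H^\alpha_\mu(q_n))\to1$ as $n\to\infty$ (in particular $H^\alpha_\mu(q_n)$ is finite for all large $n$). **Claim.** Let $(q_n)$ be asymptotically optimal for $\mu$. Then $0<\int g^{\beta_1}\,d\lambda<\infty$, so that $$\hat\mu(E)=\frac{\int_E g^{\beta_1}\,d\lambda}{\int_{\mathbb R}g^{\beta_1}\,d\lambda}$$ defines a Borel probability measure on $\mathbb R$, and the following hold. (i) For all real $c<d$, $$\lim_{n\to\infty}\frac{\int_{(c,d]}|x-q_n(x)|^r g(x)\,d\lambda(x)}{\int_{\mathbb R}|x-q_n(x)|^r g(x)\,d\lambda(x)}=\hat\mu((c,d]).$$ (ii) The measures $M^n_g(E)=e^{rH^\alpha_\mu(q_n)}\int_E|x-q_n(x)|^r g(x)\,d\lambda(x)$, which are finite for all large $n$, converge weakly (tested against bounded continuous functions) to the finite measure $$M_g(E)=C(r)\left(\int_E g^{\beta_1}\,d\lambda\right)\left(\int_{\mathbb R}g^{\beta_1}\,d\lambda\right)^{r/(1-\alpha)}.$$ -/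

import Mathlib

open MeasureTheory Filter Topology
open scoped ENNReal BoundedContinuousFunction

noncomputable section

namespace RenyiQuantization

/-- `g` is a probability density function on the real line. -/
structure IsProbDensity (g : ℝ → ℝ) : Prop where
  measurable : Measurable g
  nonneg : ∀ x, 0 ≤ g x
  lintegral_eq_one : ∫⁻ x, ENNReal.ofReal (g x) = 1

/-- The distribution `g λ` with density `g` with respect to Lebesgue measure. -/
def densMeasure (g : ℝ → ℝ) : Measure ℝ :=
  volume.withDensity (fun x => ENNReal.ofReal (g x))

/-- A probability density is weakly unimodal if it is continuous on its support (the smallest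
closed set whose complement has measure zero) and all its superlevel sets at sufficiently small
positive levels are compact intervals. -/
structure IsWeaklyUnimodal (g : ℝ → ℝ) : Prop extends IsProbDensity g where
  continuousOn_support : ContinuousOn g (densMeasure g).support
  superlevel : ∃ l₀ : ℝ, 0 < l₀ ∧ ∀ l : ℝ, 0 < l → l < l₀ →
    ∃ a b : ℝ, a ≤ b ∧ {x | l ≤ g x} = Set.Icc a b

/-- A scalar quantizer: a Borel map with countable range, whose codecells `q ⁻¹' {q x}` are
intervals, and each of whose codepoints lies in the interior of its codecell. -/
structure IsQuantizer (q : ℝ → ℝ) : Prop where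
  measurable : Measurable q
  countable_range : (Set.range q).Countable
  ordConnected : ∀ x, (q ⁻¹' {q x}).OrdConnected
  mem_interior : ∀ x, q x ∈ interior (q ⁻¹' {q x})

/-- The Rényi entropy of order `α` (natural logarithm) of the quantizer `q` with respect to `μ`,
with values in the extended reals; the sum runs over the codepoints of `q`. -/
def renyiEntropy (α : ℝ) (μ : Measure ℝ) (q : ℝ → ℝ) : EReal :=
  ((1 / (1 - α) : ℝ) : EReal) * ENNReal.log (∑' a : Set.range q, μ (q ⁻¹' {(a : ℝ)}) ^ α)

/-- The contribution `∫_E |x - q(x)|^r dμ(x)` of the set `E` to the `r`th power distortion. -/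
def distortionOn (r : ℝ) (μ : Measure ℝ) (q : ℝ → ℝ) (E : Set ℝ) : ℝ≥0∞ :=
  ∫⁻ x in E, ENNReal.ofReal (|x - q x| ^ r) ∂μ

/-- The `r`th power distortion of `q` with respect to `μ`. -/
def distortion (r : ℝ) (μ : Measure ℝ) (q : ℝ → ℝ) : ℝ≥0∞ :=
  ∫⁻ x, ENNReal.ofReal (|x - q x| ^ r) ∂μ

/-- The optimal `r`th power distortion of `μ` under the entropy constraint `R`.
(For `R = ⊤` there is no constraint.) -/
def optDistortion (α r : ℝ) (μ : Measure ℝ) (R : EReal) : ℝ≥0∞ :=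
  ⨅ (q : ℝ → ℝ) (_ : IsQuantizer q ∧ renyiEntropy α μ q ≤ R), distortion r μ q

/-- `(q n)` is an asymptotically optimal sequence of quantizers for `μ`: the entropies tend to
infinity, and the ratio of the distortion to the optimal distortion at the same entropy tends
to `1`. The ratio is taken in `[0, ∞]`, where `x / 0 = ∞` for `x > 0`, `0 / 0 = 0` and
`∞ / ∞ = 0`, so that the limit `1` forces numerator and denominator to be eventually positive
and finite. -/
structure IsAsymptoticallyOptimal (α r : ℝ) (μ : Measure ℝ) (q : ℕ → ℝ → ℝ) : Prop where
  isQuantizer : ∀ n, IsQuantizer (q n)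
  tendsto_entropy : Tendsto (fun n => renyiEntropy α μ (q n)) atTop (𝓝 ⊤)
  tendsto_ratio : Tendsto
    (fun n => distortion r μ (q n) / optDistortion α r μ (renyiEntropy α μ (q n))) atTop (𝓝 1)

/-- The exponent `β₁ = (1 - α + α r) / (1 - α + r)`. -/
def beta₁ (α r : ℝ) : ℝ := (1 - α + α * r) / (1 - α + r)

/-- The constant `C(r) = 1 / (2 ^ r (1 + r))`. -/
def constC (r : ℝ) : ℝ := 1 / (2 ^ r * (1 + r))

/-- The measure `E ↦ ∫_E g ^ β₁ dλ`. -/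
def powMeasure (α r : ℝ) (g : ℝ → ℝ) : Measure ℝ :=
  volume.withDensity (fun x => ENNReal.ofReal (g x ^ beta₁ α r))

/-- The measure `E ↦ ∫_E g ^ β₁ dλ / ∫ g ^ β₁ dλ`. -/
def muHat (α r : ℝ) (g : ℝ → ℝ) : Measure ℝ :=
  (∫⁻ x, ENNReal.ofReal (g x ^ beta₁ α r))⁻¹ • powMeasure α r g

/-- The scaled distortion measure `E ↦ e ^ (r H) ∫_E |x - q(x)| ^ r g(x) dx` of a quantizer `q`,
where `H` is the Rényi entropy of `q` with respect to `g λ`. -/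
def scaledDistortionMeasure (α r : ℝ) (g : ℝ → ℝ) (q : ℝ → ℝ) : Measure ℝ :=
  EReal.exp ((r : EReal) * renyiEntropy α (densMeasure g) q) •
    volume.withDensity (fun x => ENNReal.ofReal (|x - q x| ^ r * g x))

/-- The measure `E ↦ C(r) (∫_E g ^ β₁ dλ) (∫ g ^ β₁ dλ) ^ (r / (1 - α))`. -/
def limitMeasure (α r : ℝ) (g : ℝ → ℝ) : Measure ℝ :=
  (ENNReal.ofReal (constC r) *
      (∫⁻ x, ENNReal.ofReal (g x ^ beta₁ α r)) ^ (r / (1 - α))) • powMeasure α r g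

/-- Weak convergence of a sequence of measures, almost all of which are finite, to a finite
measure: convergence of the integrals of all bounded continuous functions. -/
structure ConvergesWeakly (M : ℕ → Measure ℝ) (L : Measure ℝ) : Prop where
  finite_limit : IsFiniteMeasure L
  eventually_finite : ∀ᶠ n in atTop, IsFiniteMeasure (M n)
  tendsto_integral : ∀ f : ℝ →ᵇ ℝ,
    Tendsto (fun n => ∫ x, f x ∂(M n)) atTop (𝓝 (∫ x, f x ∂L))

end RenyiQuantization

end

namespace RenyiQuantization

/-! Write D for the distortion of q, S for the sum of μ(cell)^α, A for ∫ g^β₁, C for C(r), and θ =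
(1-α)/(1-α+r). Since e^{rH} = S^{r/(1-α)}, one has e^{rH} D = C·P^{1/θ} with P = (D/C)^θ S^{1-θ}.
The whole theorem is about the extremal value A of P and the rigidity of the near-minimizers.

Upper bound (`exists_isQuantizer_le`): cells on which G^θ has integral h, for a slowly varying
majorant G of g, give D ≤ C h^r A' and S ≤ h^{α-1} A' with A' as close to A as desired. Eliminating
h shows that asymptotically optimal sequences have limsup P ≤ A.

Lower bound (`IsWeaklyUnimodal.exists_le_distortionOn_mul_cellSum`): on a short cell J, where g is
nearly constant, the moment inequality gives ∫_J g^β₁ ≲ (D_J/C)^θ (μ(J)^α)^{1-θ}. Hölder's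
inequality over the cells then gives, for every interval I, ∫_I g^β₁ ≲ (D_I/C)^θ S_I^{1-θ} as soon
as D is small.

Rigidity: cut the line at c. D splits exactly; S splits up to an error 1, because only one cell
contains c, and S → ∞. The two local lower bounds and the global upper bound then force equality in
a two-term Hölder inequality in the limit (`tendsto_of_holder_eq`). Hence the share of D carried by
(-∞, c] tends to that of g^β₁, and P → A. The first gives (i) and weak convergence of the normalized
distortion; the second supplies the total mass in (ii). -/

/-! ### Weakly unimodal densities: semicontinuity and decay. -/

theorem densMeasure_apply {g : ℝ → ℝ} (s : Set ℝ) :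
    densMeasure g s = ∫⁻ x in s, ENNReal.ofReal (g x) := by
  rw [densMeasure, withDensity_apply' _ s]

/-- Below a level whose superlevel set has positive measure, the superlevel intervals are
nondegenerate, hence contained in the support, where continuity of g is available. A one-point
superlevel set could lie outside the support. -/
theorem IsWeaklyUnimodal.exists_superlevel {g : ℝ → ℝ} (hg : IsWeaklyUnimodal g) :
    ∃ l₁ : ℝ, 0 < l₁ ∧ ∀ l, 0 < l → l ≤ l₁ → ∃ a b : ℝ, a ≤ b ∧ {x | l ≤ g x} = Set.Icc a b ∧
      Set.Icc a b ⊆ (densMeasure g).support := by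
  obtain ⟨l₀, hl₀, H⟩ := hg.superlevel
  -- Otherwise g = 0 almost everywhere. The shift by 2 keeps the level strictly below l₀ even for n
  -- = 0.
  have hpos : ∃ n : ℕ, volume {x | l₀ / (n + 2) ≤ g x} ≠ 0 := by
    by_contra! hcon
    have h0 : volume {x | 0 < g x} = 0 := by
      refine measure_mono_null ?_ (measure_iUnion_null hcon)
      intro x hx
      obtain ⟨n, hn⟩ := exists_nat_gt (l₀ / g x)
      have hx' : 0 < g x := hx
      refine Set.mem_iUnion.2 ⟨n, ?_⟩
      rw [Set.mem_ofPred_eq, div_le_iff₀ (by positivity)]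
      rw [div_lt_iff₀ hx'] at hn
      nlinarith
    have h1 := hg.lintegral_eq_one
    have h2 : (fun x => ENNReal.ofReal (g x)) =ᵐ[volume] 0 := by
      filter_upwards [measure_eq_zero_iff_ae_notMem.1 h0] with x hx
      simpa using hx
    rw [lintegral_congr_ae h2] at h1
    simp at h1
  obtain ⟨n, hn⟩ := hpos
  have hl1 : 0 < l₀ / (n + 2) := by positivity
  refine ⟨l₀ / (n + 2), hl1, fun l hl hll => ?_⟩
  have hlt : l₀ / (n + 2) < l₀ := div_lt_self hl₀ (by linarith [n.cast_nonneg (α := ℝ)])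
  obtain ⟨a, b, hab, hK⟩ := H l hl (hll.trans_lt hlt)
  refine ⟨a, b, hab, hK, ?_⟩
  have hlt' : a < b := by
    rcases hab.lt_or_eq with h | h
    · exact h
    · exfalso
      apply hn
      refine measure_mono_null (t := Set.Icc a b) ?_ (by simp [h])
      rw [← hK]
      exact fun x hx => hll.trans hx
  intro x hx
  rw [Measure.mem_support_iff_forall]
  intro U hU
  obtain ⟨V, hVU, hV, hxV⟩ := mem_nhds_iff.1 hU
  have hxc : x ∈ closure (Set.Ioo a b) := by rwa [closure_Ioo hlt'.ne]
  have hne : (V ∩ Set.Ioo a b).Nonempty := mem_closure_iff.1 hxc V hV hxV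
  have hvol : 0 < volume (V ∩ Set.Ioo a b) := (hV.inter isOpen_Ioo).measure_pos _ hne
  calc 0 < ENNReal.ofReal l * volume (V ∩ Set.Ioo a b) :=
        ENNReal.mul_pos (by simpa using hl) hvol.ne'
    _ = ∫⁻ x in V ∩ Set.Ioo a b, ENNReal.ofReal l := by simp
    _ ≤ ∫⁻ x in V ∩ Set.Ioo a b, ENNReal.ofReal (g x) := by
        refine setLIntegral_mono' (hV.inter isOpen_Ioo).measurableSet fun y hy => ?_
        refine ENNReal.ofReal_le_ofReal ?_
        have : y ∈ {x | l ≤ g x} := hK ▸ Set.Ioo_subset_Icc_self hy.2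
        exact this
    _ = densMeasure g (V ∩ Set.Ioo a b) := (densMeasure_apply _).symm
    _ ≤ densMeasure g U := measure_mono (Set.inter_subset_left.trans hVU)

/-- Off the support g vanishes, since small superlevel sets lie in the support. So leaving the
closed support can only make g drop, and on it g is continuous. -/
theorem IsWeaklyUnimodal.upperSemicontinuous {g : ℝ → ℝ} (hg : IsWeaklyUnimodal g) :
    UpperSemicontinuous g := by
  obtain ⟨l₁, hl₁, H⟩ := hg.exists_superlevel
  have hsupp : ∀ x, x ∉ (densMeasure g).support → g x = 0 := by
    intro x hx
    by_contra hne
    have hgx : 0 < g x := lt_of_le_of_ne (hg.nonneg x) (Ne.symm hne)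
    obtain ⟨a, b, -, hK, hsub⟩ := H (min (g x) l₁) (lt_min hgx hl₁) (min_le_right _ _)
    exact hx (hsub (hK ▸ (min_le_left (g x) l₁ : x ∈ {y | min (g x) l₁ ≤ g y})))
  intro x y hy
  by_cases hx : x ∈ (densMeasure g).support
  · have hc := (hg.continuousOn_support x hx).eventually_lt_const hy
    rw [eventually_nhdsWithin_iff] at hc
    filter_upwards [hc] with z hz
    by_cases hzs : z ∈ (densMeasure g).support
    · exact hz hzs
    · rw [hsupp z hzs]
      exact (hg.nonneg x).trans_lt hy
  · filter_upwards [Measure.isClosed_support.isOpen_compl.mem_nhds hx] with z hz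
    rw [hsupp z hz]
    exact (hg.nonneg x).trans_lt hy

/-- For |x| large, g x ≤ l₁ ≤ g a, so the superlevel set at level g x is an interval containing both
a and x, and x/2 lies between them. -/
theorem IsWeaklyUnimodal.exists_le_between {g : ℝ → ℝ} (hg : IsWeaklyUnimodal g) :
    ∃ R : ℝ, 2 ≤ R ∧ ∀ x, R ≤ |x| → ∀ y ∈ Set.uIcc (x / 2) x, g x ≤ g y := by
  obtain ⟨l₁, hl₁, H⟩ := hg.exists_superlevel
  obtain ⟨a, b, hab, hK, -⟩ := H l₁ hl₁ le_rfl
  have ha : l₁ ≤ g a := by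
    have : a ∈ {x | l₁ ≤ g x} := hK ▸ Set.left_mem_Icc.2 hab
    exact this
  refine ⟨2 + 2 * |a| + |b|, by linarith [abs_nonneg a, abs_nonneg b], fun x hxR y hy => ?_⟩
  have hx : g x ≤ l₁ := by
    by_contra! hlt
    have hxK : x ∈ Set.Icc a b := hK ▸ (hlt.le : x ∈ {z | l₁ ≤ g z})
    rcases abs_cases x with ⟨h, -⟩ | ⟨h, -⟩
    · linarith [hxK.2, le_abs_self b, abs_nonneg a]
    · linarith [hxK.1, neg_abs_le a, abs_nonneg a, abs_nonneg b]
  rcases (hg.nonneg x).eq_or_lt with h0 | h0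
  · rw [← h0]
    exact hg.nonneg y
  obtain ⟨a', b', -, hK', -⟩ := H (g x) h0 hx
  have hxa : x ∈ Set.Icc a' b' := hK' ▸ (le_refl (g x) : x ∈ {z | g x ≤ g z})
  have haa : a ∈ Set.Icc a' b' := hK' ▸ (hx.trans ha : a ∈ {z | g x ≤ g z})
  have hya : y ∈ Set.uIcc a x := by
    rw [Set.mem_uIcc] at hy ⊢
    rcases abs_cases x with ⟨h, -⟩ | ⟨h, -⟩
    · left
      constructor <;> rcases hy with hy | hy <;> 
        linarith [le_abs_self a, abs_nonneg a, abs_nonneg b, hy.1, hy.2]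
    · right
      constructor <;> rcases hy with hy | hy <;>
        linarith [neg_abs_le a, abs_nonneg a, abs_nonneg b, hy.1, hy.2]
  have : y ∈ {z | g x ≤ g z} := hK' ▸ (Set.ordConnected_Icc.uIcc_subset haa hxa hya)
  exact this

theorem IsWeaklyUnimodal.exists_bound {g : ℝ → ℝ} (hg : IsWeaklyUnimodal g) :
    ∃ B : ℝ, 0 < B ∧ ∀ x, g x ≤ B := by
  obtain ⟨l₁, hl₁, H⟩ := hg.exists_superlevel
  obtain ⟨a, b, hab, hK, hsub⟩ := H l₁ hl₁ le_rfl
  obtain ⟨B, hB⟩ := (isCompact_Icc.image_of_continuousOn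
    (hg.continuousOn_support.mono hsub)).bddAbove
  refine ⟨max B l₁, lt_max_of_lt_right hl₁, fun x => ?_⟩
  rcases le_total l₁ (g x) with h | h
  · exact le_max_of_le_left (hB ⟨x, hK ▸ (h : x ∈ {z | l₁ ≤ g z}), rfl⟩)
  · exact le_max_of_le_right h

/-- Far out, g ≥ g x on the interval between x/2 and x, which has length |x|/2; its part of the
moment is thus at least g x · (|x|/2)^{1+r+δ}. The surplus δ can be dropped. The weight √(1+x²) is
cosh(arsinh x), which suits the scale used for the majorants. -/
theorem IsWeaklyUnimodal.exists_decay {g : ℝ → ℝ} (hg : IsWeaklyUnimodal g) {r : ℝ} (hr : 1 < r)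
    (hmoment : ∃ δ : ℝ, 0 < δ ∧ ∫⁻ x, ENNReal.ofReal (|x| ^ (r + δ)) ∂(densMeasure g) < ⊤) :
    ∃ C : ℝ, 0 < C ∧ ∀ x, g x ≤ C * √(1 + x ^ 2) ^ (-(1 + r)) := by
  obtain ⟨B, hB, hgB⟩ := hg.exists_bound
  obtain ⟨R, hR2, hR⟩ := hg.exists_le_between
  obtain ⟨δ, hδ, hM⟩ := hmoment
  set M := (∫⁻ x, ENNReal.ofReal (|x| ^ (r + δ)) ∂(densMeasure g)).toReal
  have hM0 : 0 ≤ M := ENNReal.toReal_nonneg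
  have hfar : ∀ x, R ≤ |x| → g x * (|x| / 2) ^ (1 + r) ≤ M := by
    intro x hx
    have hx1 : 1 ≤ |x| / 2 := by linarith
    have hle : g x * (|x| / 2) ^ (1 + r) ≤ (|x| / 2) ^ (r + δ) * g x * (|x| / 2) := by
      rw [add_comm 1 r, Real.rpow_add_one (by positivity)]
      have := Real.rpow_le_rpow_of_exponent_le hx1 (by linarith : r ≤ r + δ)
      have h2 := mul_le_mul_of_nonneg_right this
        (mul_nonneg (hg.nonneg x) (by positivity : 0 ≤ |x| / 2))
      linarith
    refine hle.trans ((ENNReal.ofReal_le_iff_le_toReal hM.ne).1 ?_)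
    have hvol : volume (Set.uIcc (x / 2) x) = ENNReal.ofReal (|x| / 2) := by
      rw [Real.volume_interval]
      congr 1
      rw [show x - x / 2 = x / 2 by ring, abs_div, abs_two]
    calc ENNReal.ofReal ((|x| / 2) ^ (r + δ) * g x * (|x| / 2))
        = ∫⁻ y in Set.uIcc (x / 2) x, ENNReal.ofReal ((|x| / 2) ^ (r + δ) * g x) := by
          rw [setLIntegral_const, hvol, ← ENNReal.ofReal_mul
            (mul_nonneg (by positivity) (hg.nonneg x))]
      _ ≤ ∫⁻ y in Set.uIcc (x / 2) x, ENNReal.ofReal (g y) * ENNReal.ofReal (|y| ^ (r + δ)) := by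
          refine setLIntegral_mono' measurableSet_uIcc fun y hy => ?_
          rw [← ENNReal.ofReal_mul (hg.nonneg y), mul_comm]
          refine ENNReal.ofReal_le_ofReal ?_
          refine mul_le_mul (hR x hx y hy) ?_ (by positivity) (hg.nonneg y)
          refine Real.rpow_le_rpow (by positivity) ?_ (by linarith)
          rw [Set.mem_uIcc] at hy
          rcases abs_cases x with ⟨h, h'⟩ | ⟨h, h'⟩
          · refine le_trans ?_ (le_abs_self y)
            rcases hy with hy | hy <;> linarith [hy.1, hy.2]
          · refine le_trans ?_ (neg_le_abs y)
            rcases hy with hy | hy <;> linarith [hy.1, hy.2]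
      _ ≤ ∫⁻ y, ENNReal.ofReal (g y) * ENNReal.ofReal (|y| ^ (r + δ)) := setLIntegral_le_lintegral _ _
      _ = ∫⁻ x, ENNReal.ofReal (|x| ^ (r + δ)) ∂(densMeasure g) := by
          rw [densMeasure, lintegral_withDensity_eq_lintegral_mul _
            hg.measurable.ennreal_ofReal (by fun_prop)]
          rfl
  have hw : ∀ x : ℝ, 0 < √(1 + x ^ 2) := fun x => by positivity
  refine ⟨B * √(1 + R ^ 2) ^ (1 + r) + 4 ^ (1 + r) * M, by positivity, fun x => ?_⟩
  rw [Real.rpow_neg (hw x).le, ← div_eq_mul_inv, le_div_iff₀ (Real.rpow_pos_of_pos (hw x) _)]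
  rcases le_total R |x| with hx | hx
  · have h1 : √(1 + x ^ 2) ≤ 4 * (|x| / 2) := by
      rw [Real.sqrt_le_left (by positivity)]
      nlinarith [sq_abs x]
    calc g x * √(1 + x ^ 2) ^ (1 + r) ≤ g x * (4 * (|x| / 2)) ^ (1 + r) := by
          refine mul_le_mul_of_nonneg_left ?_ (hg.nonneg x)
          exact Real.rpow_le_rpow (hw x).le h1 (by linarith)
      _ = 4 ^ (1 + r) * (g x * (|x| / 2) ^ (1 + r)) := by
          rw [Real.mul_rpow (by norm_num) (by positivity)]; ring
      _ ≤ 4 ^ (1 + r) * M := mul_le_mul_of_nonneg_left (hfar x hx) (by positivity)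
      _ ≤ _ := le_add_of_nonneg_left (by positivity)
  · have h1 : √(1 + x ^ 2) ≤ √(1 + R ^ 2) :=
      Real.sqrt_le_sqrt (by nlinarith [sq_abs x, abs_nonneg x])
    calc g x * √(1 + x ^ 2) ^ (1 + r) ≤ B * √(1 + R ^ 2) ^ (1 + r) :=
          mul_le_mul (hgB x) (Real.rpow_le_rpow (hw x).le h1 (by linarith)) (by positivity) hB.le
      _ ≤ _ := le_add_of_nonneg_right (by positivity)

/-! ### Exponent identities and integrability of g^β₁. -/

/-- The Hölder exponent `(1 - α) / (1 - α + r)`. -/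
noncomputable def theta (α r : ℝ) : ℝ := (1 - α) / (1 - α + r)

section exponents

variable {α r : ℝ}

theorem theta_pos (hr : 1 < r) (hα₁ : α < 1) : 0 < theta α r :=
  div_pos (by linarith) (by linarith)

theorem one_sub_theta (hr : 1 < r) (hα₁ : α < 1) : 1 - theta α r = r / (1 - α + r) := by
  have : 1 - α + r ≠ 0 := by linarith
  rw [theta]; field_simp; ring

theorem theta_lt_one (hr : 1 < r) (hα₁ : α < 1) : theta α r < 1 := by
  have := one_sub_theta (α := α) hr hα₁
  have h2 : 0 < r / (1 - α + r) := div_pos (by linarith) (by linarith)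
  linarith

/-- The θ-th power of a function decaying like |x|^{-(1+r)} has infinite integral on each half line;
this makes the compressor surjective. -/
theorem theta_mul_lt_one (hr : 1 < r) (hα₀ : 0 < α) (hα₁ : α < 1) :
    (1 + r) * theta α r < 1 := by
  rw [theta, ← mul_div_assoc, div_lt_one (by linarith)]
  nlinarith

theorem beta₁_eq (hr : 1 < r) (hα₁ : α < 1) : beta₁ α r = 1 - r * theta α r := by
  have : 1 - α + r ≠ 0 := by linarith
  rw [beta₁, theta]; field_simp; ring

theorem beta₁_eq' (hr : 1 < r) (hα₁ : α < 1) :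
    beta₁ α r = α + theta α r * (1 - α) := by
  have : 1 - α + r ≠ 0 := by linarith
  rw [beta₁, theta]; field_simp; ring

theorem beta₁_pos (hr : 1 < r) (hα₀ : 0 < α) (hα₁ : α < 1) : 0 < beta₁ α r :=
  div_pos (by nlinarith) (by linarith)

/-- This is what makes the β₁-th power of the decay bound integrable. -/
theorem one_lt_mul_beta₁ (hr : 1 < r) (hα₀ : 0 < α) (hα₁ : α < 1) :
    1 < (1 + r) * beta₁ α r := by
  rw [beta₁, ← mul_div_assoc, one_lt_div (by linarith)]
  nlinarith [mul_pos hα₀ (by linarith : 0 < r), mul_pos (mul_pos hα₀ (by linarith : 0 < r))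
    (by linarith : 0 < r)]

theorem constC_pos (hr : 1 < r) : 0 < constC r := by
  rw [constC]
  have : 0 < 1 + r := by linarith
  positivity

end exponents

theorem lintegral_decay_lt_top {C s β : ℝ} (hC : 0 < C) (hsβ : 1 < s * β) :
    ∫⁻ x : ℝ, ENNReal.ofReal ((C * √(1 + x ^ 2) ^ (-s)) ^ β) < ⊤ := by
  have hi : Integrable (fun x : ℝ => (1 + ‖x‖ ^ 2) ^ (-(s * β) / 2)) :=
    integrable_rpow_neg_one_add_norm_sq (by simpa using hsβ)
  refine lt_of_le_of_lt (lintegral_mono fun x => ?_) (hi.const_mul (C ^ β)).lintegral_lt_top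
  refine ENNReal.ofReal_le_ofReal (le_of_eq ?_)
  rw [Real.mul_rpow hC.le (by positivity), Real.sqrt_eq_rpow, ← Real.rpow_mul (by positivity),
    ← Real.rpow_mul (by positivity), Real.norm_eq_abs, sq_abs]
  congr 2
  ring

theorem lintegral_rpow_beta₁_lt_top {α r : ℝ} (hr : 1 < r) (hα₀ : 0 < α) (hα₁ : α < 1)
    {g : ℝ → ℝ} (hg : ∀ x, 0 ≤ g x) {C : ℝ} (hC : 0 < C)
    (hgC : ∀ x, g x ≤ C * √(1 + x ^ 2) ^ (-(1 + r))) :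
    ∫⁻ x, ENNReal.ofReal (g x ^ beta₁ α r) < ⊤ :=
  (lintegral_mono fun x => ENNReal.ofReal_le_ofReal
    (Real.rpow_le_rpow (hg x) (hgC x) (beta₁_pos hr hα₀ hα₁).le)).trans_lt
    (lintegral_decay_lt_top hC (one_lt_mul_beta₁ hr hα₀ hα₁))

theorem IsProbDensity.lintegral_rpow_pos {g : ℝ → ℝ} (hg : IsProbDensity g) (β : ℝ) :
    0 < ∫⁻ x, ENNReal.ofReal (g x ^ β) := by
  rw [pos_iff_ne_zero, Ne, lintegral_eq_zero_iff (by have := hg.measurable; fun_prop)]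
  intro h
  have h1 := hg.lintegral_eq_one
  have h2 : (fun x => ENNReal.ofReal (g x)) =ᵐ[volume] 0 := by
    filter_upwards [h] with x hx
    simp only [Pi.zero_apply, ENNReal.ofReal_eq_zero] at hx ⊢
    by_contra! hlt
    exact absurd (Real.rpow_pos_of_pos hlt β) hx.not_gt
  rw [lintegral_congr_ae h2] at h1
  simp at h1

/-! ### Slowly varying majorants. -/

/-- The `k`-Lipschitz upper regularization of a function that is bounded above. -/
noncomputable def lipEnvelope (g : ℝ → ℝ) (k : ℝ) (x : ℝ) : ℝ := ⨆ y, (g y - k * |x - y|)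

section envelope

variable {g : ℝ → ℝ} {B k : ℝ}

theorem bddAbove_lipEnvelope (hgB : ∀ x, g x ≤ B) (hk : 0 ≤ k) (x : ℝ) :
    BddAbove (Set.range fun y => g y - k * |x - y|) := by
  refine ⟨B, ?_⟩
  rintro _ ⟨y, rfl⟩
  have := mul_nonneg hk (abs_nonneg (x - y))
  linarith [hgB y]

theorem le_lipEnvelope (hgB : ∀ x, g x ≤ B) (hk : 0 ≤ k) (x : ℝ) : g x ≤ lipEnvelope g k x := by
  have := le_ciSup (bddAbove_lipEnvelope hgB hk x) x
  simpa [lipEnvelope] using this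

theorem continuous_lipEnvelope (hgB : ∀ x, g x ≤ B) (hk : 0 ≤ k) :
    Continuous (lipEnvelope g k) := by
  have : LipschitzWith k.toNNReal (lipEnvelope g k) := by
    refine LipschitzWith.of_le_add_mul _ fun x y => ciSup_le fun z => ?_
    have h1 := le_ciSup (bddAbove_lipEnvelope hgB hk y) z
    have h2 : |y - z| ≤ |x - z| + |x - y| := by
      have := abs_sub_le y x z
      rw [abs_sub_comm y x] at this
      linarith
    rw [Real.coe_toNNReal k hk, Real.dist_eq]
    have h3 := mul_le_mul_of_nonneg_left h2 hk
    change _ ≤ lipEnvelope g k y at h1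
    linarith
  exact this.continuous

/-- Within distance δ of x, semicontinuity bounds g y; beyond it, the penalty nδ exceeds the bound B
on g. -/
theorem tendsto_lipEnvelope (hg0 : ∀ x, 0 ≤ g x) (hgB : ∀ x, g x ≤ B)
    (hg : UpperSemicontinuous g) (x : ℝ) :
    Tendsto (fun n : ℕ => lipEnvelope g n x) atTop (𝓝 (g x)) := by
  refine tendsto_order.2 ⟨fun a ha => Eventually.of_forall fun n =>
    ha.trans_le (le_lipEnvelope hgB n.cast_nonneg x), fun a ha => ?_⟩
  obtain ⟨b, hb1, hb2⟩ := exists_between ha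
  obtain ⟨δ, hδ, hball⟩ := Metric.eventually_nhds_iff.1 (hg x b hb1)
  obtain ⟨N, hN⟩ := exists_nat_gt (B / δ)
  filter_upwards [eventually_ge_atTop N] with n hn
  refine (ciSup_le fun y => ?_).trans_lt hb2
  have hn0 : (0 : ℝ) ≤ n := n.cast_nonneg
  rcases lt_or_ge |x - y| δ with h | h
  · have hy : dist y x < δ := by rwa [Real.dist_eq, abs_sub_comm]
    have := hball hy
    have := mul_nonneg hn0 (abs_nonneg (x - y))
    linarith
  · have hnN : (N : ℝ) ≤ n := by exact_mod_cast hn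
    have h1 : B < N * δ := by rwa [div_lt_iff₀ hδ] at hN
    have h2 : (N : ℝ) * δ ≤ n * |x - y| := mul_le_mul hnN h hδ.le hn0
    linarith [hgB y, hg0 x]

end envelope

theorem cosh_le_exp_mul_cosh (t u : ℝ) : Real.cosh t ≤ Real.exp |t - u| * Real.cosh u := by
  rw [Real.cosh_eq, Real.cosh_eq]
  have h1 : Real.exp t ≤ Real.exp |t - u| * Real.exp u := by
    rw [← Real.exp_add]
    exact Real.exp_le_exp.2 (by linarith [le_abs_self (t - u)])
  have h2 : Real.exp (-t) ≤ Real.exp |t - u| * Real.exp (-u) := by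
    rw [← Real.exp_add]
    exact Real.exp_le_exp.2 (by linarith [neg_le_abs (t - u)])
  linarith

/-- With x = sinh t, the weight is a power of cosh t, whose logarithm is Lipschitz, and log F(sinh
t) is continuous with compact support, hence uniformly continuous. -/
theorem exists_arsinh_modulus {C s N : ℝ} (hC : 0 < C) (hs : 0 < s) {F : ℝ → ℝ}
    (hFc : Continuous F) (hF0 : ∀ x, 0 < F x) (hF1 : ∀ x, N ≤ |x| → F x = 1) {κ : ℝ}
    (hκ : 1 < κ) : ∃ δ : ℝ, 0 < δ ∧ ∀ x y, |Real.arsinh x - Real.arsinh y| < δ →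
      C * √(1 + x ^ 2) ^ (-s) * F x ≤ κ * (C * √(1 + y ^ 2) ^ (-s) * F y) := by
  set f : ℝ → ℝ := fun t => Real.log (F (Real.sinh t)) with hf
  have hfc : Continuous f := by
    refine Continuous.log (hFc.comp Real.continuous_sinh) fun t => (hF0 _).ne'
  have hfs : HasCompactSupport f := by
    refine HasCompactSupport.of_support_subset_isCompact
      (isCompact_Icc (a := Real.arsinh (-N)) (b := Real.arsinh N)) fun t ht => ?_
    by_contra hnot
    apply ht
    have : F (Real.sinh t) = 1 := by
      apply hF1
      rw [Set.mem_Icc, not_and_or, not_le, not_le] at hnot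
      rcases hnot with h | h
      · have := Real.sinh_lt_sinh.2 h
        rw [Real.sinh_arsinh] at this
        exact le_trans (by linarith) (neg_le_abs _)
      · have := Real.sinh_lt_sinh.2 h
        rw [Real.sinh_arsinh] at this
        exact le_trans (by linarith) (le_abs_self _)
    simp [hf, this]
  have huc := hfs.uniformContinuous_of_continuous hfc
  have hlκ : 0 < Real.log κ := Real.log_pos hκ
  obtain ⟨δ₁, hδ₁, H⟩ := Metric.uniformContinuous_iff.1 huc (Real.log κ / 2) (by positivity)
  refine ⟨min δ₁ (Real.log κ / (2 * s)), lt_min hδ₁ (by positivity), fun x y hxy => ?_⟩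
  have hd := H (a := Real.arsinh x) (b := Real.arsinh y)
    (by rw [Real.dist_eq]; exact hxy.trans_le (min_le_left _ _))
  simp only [hf, Real.sinh_arsinh, Real.dist_eq] at hd
  have hF : F x ≤ Real.exp (Real.log κ / 2) * F y := by
    rw [← Real.log_le_log_iff (hF0 x) (mul_pos (Real.exp_pos _) (hF0 y)),
      Real.log_mul (Real.exp_pos _).ne' (hF0 y).ne', Real.log_exp]
    linarith [le_abs_self (Real.log (F x) - Real.log (F y))]
  have hw : √(1 + x ^ 2) ^ (-s) ≤ Real.exp (Real.log κ / 2) * √(1 + y ^ 2) ^ (-s) := by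
    have h := cosh_le_exp_mul_cosh (Real.arsinh y) (Real.arsinh x)
    rw [Real.cosh_arsinh, Real.cosh_arsinh, abs_sub_comm] at h
    have hx0 : 0 < √(1 + x ^ 2) := by positivity
    have hy0 : 0 < √(1 + y ^ 2) := by positivity
    rw [Real.rpow_neg hx0.le, Real.rpow_neg hy0.le, ← div_eq_mul_inv, le_div_iff₀ (by positivity),
      inv_mul_le_iff₀ (by positivity)]
    calc √(1 + y ^ 2) ^ s
        ≤ (Real.exp |Real.arsinh x - Real.arsinh y| * √(1 + x ^ 2)) ^ s :=
          Real.rpow_le_rpow hy0.le h hs.le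
      _ = Real.exp (|Real.arsinh x - Real.arsinh y| * s) * √(1 + x ^ 2) ^ s := by
          rw [Real.mul_rpow (Real.exp_pos _).le hx0.le, ← Real.exp_mul]
      _ ≤ Real.exp (Real.log κ / 2) * √(1 + x ^ 2) ^ s := by
          refine mul_le_mul_of_nonneg_right (Real.exp_le_exp.2 ?_) (by positivity)
          have := hxy.le.trans (min_le_right _ _)
          rw [le_div_iff₀ (by positivity)] at this
          linarith
      _ = _ := mul_comm _ _
  have hκ2 : Real.exp (Real.log κ / 2) * Real.exp (Real.log κ / 2) = κ := by
    rw [← Real.exp_add, add_halves, Real.exp_log (by linarith)]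
  calc C * √(1 + x ^ 2) ^ (-s) * F x
      ≤ C * (Real.exp (Real.log κ / 2) * √(1 + y ^ 2) ^ (-s)) * (Real.exp (Real.log κ / 2) * F y) := by
        refine mul_le_mul (mul_le_mul_of_nonneg_left hw hC.le) hF (hF0 x).le (by positivity)
    _ = (Real.exp (Real.log κ / 2) * Real.exp (Real.log κ / 2)) *
          (C * √(1 + y ^ 2) ^ (-s) * F y) := by ring
    _ = _ := by rw [hκ2]

/-- A regular majorant of a density, suited as a companding density: it varies slowly on the scale
of `arsinh`, and `G ^ θ` decays at most like `1 / |x|`. -/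
structure IsRegularMajorant (θ : ℝ) (g G : ℝ → ℝ) : Prop where
  continuous : Continuous G
  pos : ∀ x, 0 < G x
  le : ∀ x, g x ≤ G x
  lower : ∃ c : ℝ, 0 < c ∧ ∀ x, c * (√(1 + x ^ 2))⁻¹ ≤ G x ^ θ
  slow : ∀ κ : ℝ, 1 < κ → ∃ δ : ℝ, 0 < δ ∧ ∀ x y, |Real.arsinh x - Real.arsinh y| < δ →
    G x ≤ κ * G y

/-- The decay bound V is itself regular but too large. Multiplying it by factors F n ≤ 1 with V · F
n → g pointwise brings the integral down to that of g^β₁, by domination with V^β₁. -/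
theorem exists_isRegularMajorant {α r : ℝ} (hr : 1 < r) (hα₀ : 0 < α) (hα₁ : α < 1)
    {g : ℝ → ℝ} (hg0 : ∀ x, 0 ≤ g x) (hgu : UpperSemicontinuous g)
    {C : ℝ} (hC : 0 < C) (hgC : ∀ x, g x ≤ C * √(1 + x ^ 2) ^ (-(1 + r)))
    {A' : ℝ≥0∞} (hA' : ∫⁻ x, ENNReal.ofReal (g x ^ beta₁ α r) < A') :
    ∃ G : ℝ → ℝ, IsRegularMajorant (theta α r) g G ∧
      ∫⁻ x, ENNReal.ofReal (G x ^ beta₁ α r) < A' := by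
  set V : ℝ → ℝ := fun x => C * √(1 + x ^ 2) ^ (-(1 + r)) with hV
  have hw1 : ∀ x : ℝ, 1 ≤ √(1 + x ^ 2) := fun x => by
    rw [Real.one_le_sqrt]; nlinarith [sq_nonneg x]
  have hw0 : ∀ x : ℝ, 0 < √(1 + x ^ 2) := fun x => by positivity
  have hV0 : ∀ x, 0 < V x := fun x => mul_pos hC (Real.rpow_pos_of_pos (hw0 x) _)
  have hgB : ∀ x, g x ≤ C := fun x => (hgC x).trans (by
    have := Real.rpow_le_one_of_one_le_of_nonpos (hw1 x) (by linarith : -(1 + r) ≤ 0)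
    nlinarith)
  have hVc : Continuous V := by
    refine continuous_const.mul (Continuous.rpow_const (by fun_prop) fun x => Or.inl (hw0 x).ne')
  have hβ := beta₁_pos hr hα₀ hα₁
  have hθ := theta_pos hr hα₁
  -- The envelope term gives a continuous majorant of g/V, the term 1/(n+1) keeps the product above
  -- a multiple of V, and the last term forces F n = 1 for |x| ≥ n+1, as the arsinh modulus
  -- requires.
  set F : ℕ → ℝ → ℝ := fun n x =>
    min 1 (lipEnvelope g n x / V x + 1 / (n + 1) + max 0 (|x| - n)) with hF
  have henv0 : ∀ (n : ℕ) x, 0 ≤ lipEnvelope g n x := fun n x =>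
    (hg0 x).trans (le_lipEnvelope hgB n.cast_nonneg x)
  have hFη : ∀ (n : ℕ) x, 1 / ((n : ℝ) + 1) ≤ F n x := fun n x => by
    refine le_min ?_ ?_
    · rw [div_le_one (by positivity)]
      linarith [n.cast_nonneg (α := ℝ)]
    · have := div_nonneg (henv0 n x) (hV0 x).le
      linarith [le_max_left 0 (|x| - n)]
  have hFpos : ∀ (n : ℕ) x, 0 < F n x := fun n x => lt_of_lt_of_le (by positivity) (hFη n x)
  have hFc : ∀ n, Continuous (F n) := fun n => by
    refine continuous_const.min ((((continuous_lipEnvelope hgB n.cast_nonneg).div hVc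
      fun x => (hV0 x).ne').add continuous_const).add ?_)
    fun_prop
  have hF1 : ∀ (n : ℕ) x, (n : ℝ) + 1 ≤ |x| → F n x = 1 := fun n x hx => by
    refine min_eq_left ?_
    have h1 := div_nonneg (henv0 n x) (hV0 x).le
    have h2 : 0 < 1 / ((n : ℝ) + 1) := by positivity
    linarith [le_max_right 0 (|x| - n)]
  have hmaj : ∀ n, IsRegularMajorant (theta α r) g (fun x => V x * F n x) := fun n => by
    refine ⟨hVc.mul (hFc n), fun x => mul_pos (hV0 x) (hFpos n x), fun x => ?_, ?_, fun κ hκ =>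
      exists_arsinh_modulus hC (by linarith) (hFc n) (hFpos n) (hF1 n) hκ⟩
    · have h1 : g x / V x ≤ F n x := by
        refine le_min ((div_le_one (hV0 x)).2 (hgC x)) ?_
        have h2 : 0 < 1 / ((n : ℝ) + 1) := by positivity
        have h3 := div_le_div_of_nonneg_right (le_lipEnvelope hgB n.cast_nonneg x) (hV0 x).le
        linarith [le_max_left 0 (|x| - n)]
      rw [div_le_iff₀ (hV0 x)] at h1
      linarith
    · refine ⟨(C * (1 / ((n : ℝ) + 1))) ^ theta α r, by positivity, fun x => ?_⟩
      have h1 : (√(1 + x ^ 2))⁻¹ ≤ (√(1 + x ^ 2) ^ (-(1 + r))) ^ theta α r := by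
        rw [← Real.rpow_mul (hw0 x).le, ← Real.rpow_neg_one]
        refine Real.rpow_le_rpow_of_exponent_le (hw1 x) ?_
        linarith [theta_mul_lt_one hr hα₀ hα₁]
      calc (C * (1 / ((n : ℝ) + 1))) ^ theta α r * (√(1 + x ^ 2))⁻¹
          ≤ (C * (1 / ((n : ℝ) + 1))) ^ theta α r * (√(1 + x ^ 2) ^ (-(1 + r))) ^ theta α r :=
            mul_le_mul_of_nonneg_left h1 (by positivity)
        _ = (V x * (1 / ((n : ℝ) + 1))) ^ theta α r := by
            rw [← Real.mul_rpow (by positivity) (by positivity)]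
            congr 1
            simp only [hV]
            ring
        _ ≤ (V x * F n x) ^ theta α r := by
            refine Real.rpow_le_rpow (mul_nonneg (hV0 x).le (by positivity)) ?_ hθ.le
            exact mul_le_mul_of_nonneg_left (hFη n x) (hV0 x).le
  have hlim : Tendsto (fun n => ∫⁻ x, ENNReal.ofReal ((V x * F n x) ^ beta₁ α r)) atTop
      (𝓝 (∫⁻ x, ENNReal.ofReal (g x ^ beta₁ α r))) := by
    refine tendsto_lintegral_of_dominated_convergence
      (fun x => ENNReal.ofReal (V x ^ beta₁ α r)) (fun n => ?_) (fun n => ?_) ?_ ?_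
    · have := (hmaj n).continuous.measurable
      fun_prop
    · refine Eventually.of_forall fun x => ENNReal.ofReal_le_ofReal ?_
      refine Real.rpow_le_rpow ((hmaj n).pos x).le ?_ hβ.le
      exact mul_le_of_le_one_right (hV0 x).le (min_le_left _ _)
    · exact (lintegral_decay_lt_top hC (one_lt_mul_beta₁ hr hα₀ hα₁)).ne
    · refine Eventually.of_forall fun x => ?_
      refine ENNReal.tendsto_ofReal (Tendsto.rpow_const ?_ (Or.inr hβ.le))
      have h1 : Tendsto (fun n : ℕ => max 0 (|x| - n)) atTop (𝓝 0) := by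
        obtain ⟨N, hN⟩ := exists_nat_gt |x|
        refine tendsto_const_nhds.congr' ?_
        filter_upwards [eventually_ge_atTop N] with n hn
        have : (N : ℝ) ≤ n := by exact_mod_cast hn
        rw [max_eq_left]
        linarith
      have h2 := ((tendsto_const_nhds (x := (1 : ℝ))).min
        ((((tendsto_lipEnvelope hg0 hgB hgu x).div_const (V x)).add
          (tendsto_one_div_add_atTop_nhds_zero_nat (𝕜 := ℝ))).add h1)).const_mul (V x)
      have h3 : V x * min 1 (g x / V x + 0 + 0) = g x := by
        rw [add_zero, add_zero, min_eq_right ((div_le_one (hV0 x)).2 (hgC x)),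
          mul_div_cancel₀ _ (hV0 x).ne']
      rwa [h3] at h2
  obtain ⟨n, hn⟩ := (hlim.eventually_lt_const hA').exists
  exact ⟨_, hmaj n, hn⟩

/-! ### Centered moments, cell sums and companding quantizers. -/

theorem lintegral_densMeasure {g : ℝ → ℝ} (hg : Measurable g) {s : Set ℝ} (hs : MeasurableSet s)
    {f : ℝ → ℝ≥0∞} (hf : Measurable f) :
    ∫⁻ x in s, f x ∂(densMeasure g) = ∫⁻ x in s, ENNReal.ofReal (g x) * f x := by
  rw [densMeasure, restrict_withDensity hs, lintegral_withDensity_eq_lintegral_mul _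
    hg.ennreal_ofReal hf]
  rfl

theorem constC_mul_rpow {r d : ℝ} (hr : 1 < r) (hd : 0 ≤ d) :
    constC r * (2 * d) ^ (1 + r) = 2 * (d ^ (r + 1) / (r + 1)) := by
  have h2 : (0 : ℝ) < 2 ^ r := by positivity
  have hr1 : 1 + r ≠ 0 := by linarith
  have hr2 : r + 1 ≠ 0 := by linarith
  rw [constC, Real.mul_rpow (by norm_num) hd, add_comm 1 r, Real.rpow_add_one (by norm_num : (2 : ℝ) ≠ 0)]
  field_simp

theorem lintegral_abs_sub_rpow {r : ℝ} (hr : 1 < r) (a : ℝ) {Δ : ℝ} (hΔ : 0 ≤ Δ) :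
    ∫⁻ x in Set.Icc (a - Δ / 2) (a + Δ / 2), ENNReal.ofReal (|x - a| ^ r) =
      ENNReal.ofReal (constC r * Δ ^ (1 + r)) := by
  obtain ⟨d, rfl⟩ : ∃ d, Δ = 2 * d := ⟨Δ / 2, by ring⟩
  have hd : 0 ≤ d := by linarith
  have hc : Continuous fun x : ℝ => |x| ^ r := continuous_abs.rpow_const fun _ => Or.inr (by linarith)
  have hc' : Continuous fun x : ℝ => |x - a| ^ r := hc.comp (continuous_id.sub continuous_const)
  rw [← ofReal_integral_eq_lintegral_ofReal
    (hc'.integrableOn_Icc) (Eventually.of_forall fun x => by positivity), constC_mul_rpow hr hd,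
    integral_Icc_eq_integral_Ioc, ← intervalIntegral.integral_of_le (by linarith),
    intervalIntegral.integral_comp_sub_right (fun x => |x| ^ r)]
  have e1 : a - 2 * d / 2 - a = -d := by ring
  have e2 : a + 2 * d / 2 - a = d := by ring
  rw [e1, e2, ← intervalIntegral.integral_add_adjacent_intervals (b := 0)
    (hc.intervalIntegrable _ _) (hc.intervalIntegrable _ _)]
  have h1 : ∫ x in (0 : ℝ)..d, |x| ^ r = d ^ (r + 1) / (r + 1) := by
    rw [intervalIntegral.integral_congr (g := fun x => x ^ r), integral_rpow (Or.inl (by linarith)),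
      Real.zero_rpow (by linarith), sub_zero]
    intro x hx
    rw [Set.uIcc_of_le hd] at hx
    simp only [abs_of_nonneg hx.1]
  have h2 : ∫ x in (-d)..0, |x| ^ r = ∫ x in (0 : ℝ)..d, |x| ^ r := by
    have := intervalIntegral.integral_comp_neg (a := 0) (b := d) (fun x : ℝ => |x| ^ r)
    simpa using this.symm
  rw [h2, h1]
  ring_nf

/-- The sum of `μ (q⁻¹(a) ∩ E) ^ α` over the codepoints `a` of `q`. -/
noncomputable def cellSum (α : ℝ) (μ : Measure ℝ) (q : ℝ → ℝ) (E : Set ℝ) : ℝ≥0∞ :=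
  ∑' a : Set.range q, μ (q ⁻¹' {(a : ℝ)} ∩ E) ^ α

theorem renyiEntropy_eq (α : ℝ) (μ : Measure ℝ) (q : ℝ → ℝ) :
    renyiEntropy α μ q =
      ((1 / (1 - α) : ℝ) : EReal) * ENNReal.log (cellSum α μ q Set.univ) := by
  simp [renyiEntropy, cellSum]

section Companding

variable (e : ℝ ≃o ℝ)

/-- The cells of the companding quantizer with compressor `e`. -/
def compandingCell (k : ℤ) : Set ℝ := Set.Ico (e.symm k) (e.symm (k + 1))

/-- The midpoints of the cells of the companding quantizer with compressor `e`. -/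
noncomputable def compandingPoint (k : ℤ) : ℝ := (e.symm k + e.symm (k + 1)) / 2

/-- The companding quantizer with compressor `e`: a uniform quantizer conjugated by `e`,
with the codepoints moved to the midpoints of the cells. -/
noncomputable def companding (x : ℝ) : ℝ := compandingPoint e ⌊e x⌋

theorem symm_lt_symm_add_one (k : ℤ) : e.symm k < e.symm (k + 1) :=
  e.symm.strictMono (by linarith)

theorem mem_compandingCell {k : ℤ} {x : ℝ} : x ∈ compandingCell e k ↔ ⌊e x⌋ = k := by
  rw [compandingCell, Set.mem_Ico, Int.floor_eq_iff, e.symm_apply_le, e.lt_symm_apply]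

theorem compandingPoint_mem (k : ℤ) :
    compandingPoint e k ∈ Set.Ioo (e.symm k) (e.symm (k + 1)) := by
  have := symm_lt_symm_add_one e k
  constructor <;> rw [compandingPoint] <;> linarith

theorem floor_compandingPoint (k : ℤ) : ⌊e (compandingPoint e k)⌋ = k :=
  (mem_compandingCell e).1 (Set.Ioo_subset_Ico_self (compandingPoint_mem e k))

theorem compandingPoint_injective : Function.Injective (compandingPoint e) := fun j k h => by
  rw [← floor_compandingPoint e j, h, floor_compandingPoint]

theorem companding_preimage (k : ℤ) :
    companding e ⁻¹' {compandingPoint e k} = compandingCell e k := by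
  ext x
  rw [Set.mem_preimage, Set.mem_singleton_iff, companding, (compandingPoint_injective e).eq_iff,
    mem_compandingCell]

theorem range_companding : Set.range (companding e) = Set.range (compandingPoint e) := by
  ext y
  constructor
  · rintro ⟨x, rfl⟩
    exact ⟨_, rfl⟩
  · rintro ⟨k, rfl⟩
    exact ⟨compandingPoint e k, by rw [companding, floor_compandingPoint]⟩

theorem isQuantizer_companding : IsQuantizer (companding e) where
  measurable := (measurable_of_countable (compandingPoint e)).comp
    (Int.measurable_floor.comp e.continuous.measurable)
  countable_range := by
    rw [range_companding]
    exact Set.countable_range _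
  ordConnected x := by
    rw [companding, companding_preimage]
    exact Set.ordConnected_Ico
  mem_interior x := by
    rw [companding, companding_preimage, compandingCell, interior_Ico]
    exact compandingPoint_mem e _

theorem iUnion_compandingCell : ⋃ k, compandingCell e k = Set.univ :=
  Set.eq_univ_of_forall fun _ => Set.mem_iUnion.2 ⟨_, (mem_compandingCell e).2 rfl⟩

theorem pairwise_disjoint_compandingCell : Pairwise (Function.onFun Disjoint (compandingCell e)) :=
  fun _ _ hjk => Set.disjoint_left.2 fun _ hx hx' =>
    hjk (((mem_compandingCell e).1 hx).symm.trans ((mem_compandingCell e).1 hx'))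

theorem lintegral_eq_tsum_compandingCell (μ : Measure ℝ) (f : ℝ → ℝ≥0∞) :
    ∫⁻ x, f x ∂μ = ∑' k, ∫⁻ x in compandingCell e k, f x ∂μ := by
  have hm : ∀ k, MeasurableSet (compandingCell e k) := fun _ => measurableSet_Ico
  rw [← lintegral_iUnion hm (pairwise_disjoint_compandingCell e), iUnion_compandingCell,
    setLIntegral_univ]

theorem cellSum_companding (α : ℝ) (μ : Measure ℝ) :
    cellSum α μ (companding e) Set.univ = ∑' k, μ (compandingCell e k) ^ α := by
  have h : ∀ s : Set ℝ, s = Set.range (compandingPoint e) →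
      ∑' a : s, μ (companding e ⁻¹' {(a : ℝ)} ∩ Set.univ) ^ α =
        ∑' k, μ (compandingCell e k) ^ α := by
    rintro s rfl
    rw [tsum_range (fun a : ℝ => μ (companding e ⁻¹' {a} ∩ Set.univ) ^ α)
      (compandingPoint_injective e)]
    simp_rw [companding_preimage, Set.inter_univ]
  exact h _ (range_companding e)

end Companding

theorem IsRegularMajorant.continuous_rpow {θ : ℝ} {g G : ℝ → ℝ} (hG : IsRegularMajorant θ g G)
    (p : ℝ) : Continuous fun x => G x ^ p :=
  hG.continuous.rpow_const fun x => Or.inl (hG.pos x).ne'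

theorem IsRegularMajorant.exists_arsinh_le {θ : ℝ} {g G : ℝ → ℝ} (hG : IsRegularMajorant θ g G) :
    ∃ c : ℝ, 0 < c ∧ ∀ u v, u ≤ v →
      c * (Real.arsinh v - Real.arsinh u) ≤ ∫ t in u..v, G t ^ θ := by
  obtain ⟨c, hc, hlow⟩ := hG.lower
  have hw : Continuous fun x : ℝ => (√(1 + x ^ 2))⁻¹ :=
    Continuous.inv₀ (by fun_prop) fun x => by positivity
  refine ⟨c, hc, fun u v huv => ?_⟩
  rw [← intervalIntegral.integral_eq_sub_of_hasDerivAt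
    (fun x _ => Real.hasDerivAt_arsinh x) (hw.intervalIntegrable _ _),
    ← intervalIntegral.integral_const_mul]
  exact intervalIntegral.integral_mono_on huv ((hw.const_mul c).intervalIntegrable _ _)
    ((hG.continuous_rpow θ).intervalIntegrable _ _) fun x _ => hlow x

/-- The compressor is the primitive of G^θ/h. It dominates a multiple of arsinh on both half lines,
hence is onto. -/
theorem IsRegularMajorant.exists_orderIso {θ : ℝ} {g G : ℝ → ℝ} (hG : IsRegularMajorant θ g G)
    {h : ℝ} (hh : 0 < h) :
    ∃ e : ℝ ≃o ℝ, ∀ u v, ∫ x in u..v, G x ^ θ = h * (e v - e u) := by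
  obtain ⟨c, hc, hars⟩ := hG.exists_arsinh_le
  have hcont := hG.continuous_rpow θ
  set Φ : ℝ → ℝ := fun x => (∫ t in (0 : ℝ)..x, G t ^ θ) / h with hΦ
  have hint : ∀ u v, ∫ x in u..v, G x ^ θ = h * (Φ v - Φ u) := fun u v => by
    rw [← intervalIntegral.integral_interval_sub_left (hcont.intervalIntegrable 0 v)
      (hcont.intervalIntegrable 0 u)]
    simp only [hΦ]
    field_simp
  have hmono : StrictMono Φ := fun u v huv => by
    have : 0 < ∫ x in u..v, G x ^ θ :=
      intervalIntegral.intervalIntegral_pos_of_pos (hcont.intervalIntegrable _ _)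
        (fun x => Real.rpow_pos_of_pos (hG.pos x) θ) huv
    rw [hint] at this
    exact sub_pos.1 (pos_of_mul_pos_right this hh.le)
  have hΦc : Continuous Φ :=
    (intervalIntegral.continuous_primitive (fun a b => hcont.intervalIntegrable a b) 0).div_const h
  have hΦ0 : Φ 0 = 0 := by simp [hΦ]
  have hsurj : Function.Surjective Φ := by
    refine hΦc.surjective ?_ ?_
    · refine tendsto_atTop_atTop.2 fun b => ⟨Real.sinh (|b| * h / c), fun x hx => ?_⟩
      have hx0 : Real.sinh (|b| * h / c) ≥ 0 := Real.sinh_nonneg_iff.2 (by positivity)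
      have h1 := hars 0 x (hx0.trans hx)
      rw [hint, hΦ0, Real.arsinh_zero, sub_zero, sub_zero] at h1
      have h2 := Real.arsinh_le_arsinh.2 hx
      rw [Real.arsinh_sinh, div_le_iff₀ hc] at h2
      have : |b| ≤ Φ x := le_of_mul_le_mul_left (by linarith) hh
      exact (le_abs_self b).trans this
    · refine tendsto_atBot_atBot.2 fun b => ⟨Real.sinh (-(|b| * h / c)), fun x hx => ?_⟩
      have hx0 : Real.sinh (-(|b| * h / c)) ≤ 0 :=
        Real.sinh_nonpos_iff.2 (neg_nonpos.2 (by positivity))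
      have h1 := hars x 0 (hx.trans hx0)
      rw [hint, hΦ0, Real.arsinh_zero, zero_sub, zero_sub] at h1
      have h2 := Real.arsinh_le_arsinh.2 hx
      rw [Real.arsinh_sinh, le_neg, div_le_iff₀ hc] at h2
      have : |b| ≤ -Φ x := le_of_mul_le_mul_left (by linarith) hh
      linarith [neg_abs_le b]
  exact ⟨hmono.orderIsoOfSurjective Φ hsurj, hint⟩

/-! ### Upper bounds on one companding cell. -/

section CellBounds

variable {α r κ h u v : ℝ} {g G : ℝ → ℝ}

/-- On a cell of length Δ one has G^θ Δ ≈ h, so G·C·Δ^{1+r} ≈ C h^r G^{1-rθ} Δ, and 1 - rθ = β₁. The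
powers of κ record the variation of G on the cell. -/
theorem distortion_cell_le (hr : 1 < r) (hα₁ : α < 1) (hg : IsProbDensity g)
    (hG : IsRegularMajorant (theta α r) g G) (huv : u < v) (hκ : 1 ≤ κ)
    (hslow : ∀ x ∈ Set.Icc u v, ∀ y ∈ Set.Icc u v, G x ≤ κ * G y)
    (hint : ∫ x in u..v, G x ^ theta α r = h) :
    ∫⁻ x in Set.Ico u v, ENNReal.ofReal (|x - (u + v) / 2| ^ r) ∂(densMeasure g) ≤
      ENNReal.ofReal (constC r * h ^ r * κ ^ (1 + r * theta α r)) *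
        ∫⁻ x in Set.Ico u v, ENNReal.ofReal (G x ^ beta₁ α r) := by
  have hC := constC_pos hr
  have hθ := theta_pos hr hα₁
  have hΔ : 0 < v - u := by linarith
  obtain ⟨y₀, hy₀, hmin⟩ := isCompact_Icc.exists_isMinOn (Set.nonempty_Icc.2 huv.le)
    hG.continuous.continuousOn
  have hIcc : Set.Icc ((u + v) / 2 - (v - u) / 2) ((u + v) / 2 + (v - u) / 2) = Set.Icc u v := by
    congr 1 <;> ring
  have hG0 := hG.pos y₀
  have hh : ∀ y ∈ Set.Icc u v, G y ^ theta α r * (v - u) ≤ κ ^ theta α r * h := by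
    intro y hy
    rw [← hint, ← intervalIntegral.integral_const_mul,
      show G y ^ theta α r * (v - u) = ∫ _ in u..v, G y ^ theta α r by
        rw [intervalIntegral.integral_const, smul_eq_mul, mul_comm]]
    refine intervalIntegral.integral_mono_on huv.le (by simp)
      (((hG.continuous_rpow _).const_mul _).intervalIntegrable _ _) fun x hx => ?_
    rw [← Real.mul_rpow (by linarith) (hG.pos x).le]
    exact Real.rpow_le_rpow (hG.pos y).le (hslow y hy x hx) hθ.le
  have hh0 : 0 ≤ h := by
    rw [← hint]
    exact intervalIntegral.integral_nonneg huv.le fun x _ => (Real.rpow_pos_of_pos (hG.pos x) _).le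
  calc ∫⁻ x in Set.Ico u v, ENNReal.ofReal (|x - (u + v) / 2| ^ r) ∂(densMeasure g)
      = ∫⁻ x in Set.Ico u v, ENNReal.ofReal (g x) * ENNReal.ofReal (|x - (u + v) / 2| ^ r) :=
        lintegral_densMeasure hg.measurable measurableSet_Ico (by fun_prop)
    _ ≤ ∫⁻ x in Set.Ico u v,
          ENNReal.ofReal (κ * G y₀) * ENNReal.ofReal (|x - (u + v) / 2| ^ r) := by
        refine setLIntegral_mono' measurableSet_Ico fun x hx => ?_
        gcongr
        exact (hG.le x).trans (hslow x (Set.Ico_subset_Icc_self hx) y₀ hy₀)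
    _ ≤ ENNReal.ofReal (κ * G y₀) *
          ∫⁻ x in Set.Icc u v, ENNReal.ofReal (|x - (u + v) / 2| ^ r) := by
        rw [lintegral_const_mul _ (by fun_prop)]
        gcongr
        exact Set.Ico_subset_Icc_self
    _ = ENNReal.ofReal (κ * G y₀ * (constC r * (v - u) ^ r)) * volume (Set.Ico u v) := by
        rw [← hIcc, lintegral_abs_sub_rpow hr _ hΔ.le, Real.volume_Ico,
          ← ENNReal.ofReal_mul (by positivity), ← ENNReal.ofReal_mul (by positivity), add_comm 1 r,
          Real.rpow_add_one hΔ.ne']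
        ring_nf
    _ = ∫⁻ _ in Set.Ico u v, ENNReal.ofReal (κ * G y₀ * (constC r * (v - u) ^ r)) := by simp
    _ ≤ ∫⁻ y in Set.Ico u v, ENNReal.ofReal (constC r * h ^ r * κ ^ (1 + r * theta α r)) *
          ENNReal.ofReal (G y ^ beta₁ α r) := by
        refine setLIntegral_mono' measurableSet_Ico fun y hy => ?_
        have hy' := Set.Ico_subset_Icc_self hy
        have hGy := hG.pos y
        rw [← ENNReal.ofReal_mul (by positivity)]
        refine ENNReal.ofReal_le_ofReal ?_
        have h1 := Real.rpow_le_rpow (by positivity) (hh y hy') (by linarith : 0 ≤ r)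
        rw [Real.mul_rpow (by positivity) hΔ.le, Real.mul_rpow (by positivity) hh0,
          ← Real.rpow_mul hGy.le, ← Real.rpow_mul (by linarith), mul_comm (theta α r) r] at h1
        have h2 : G y = G y ^ beta₁ α r * G y ^ (r * theta α r) := by
          rw [← Real.rpow_add hGy, beta₁_eq hr hα₁, sub_add_cancel, Real.rpow_one]
        calc κ * G y₀ * (constC r * (v - u) ^ r) ≤ κ * G y * (constC r * (v - u) ^ r) := by
              gcongr
              exact hmin hy'
          _ = κ * constC r * G y ^ beta₁ α r * (G y ^ (r * theta α r) * (v - u) ^ r) := by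
              rw [mul_assoc _ (G y ^ beta₁ α r), ← mul_assoc (G y ^ beta₁ α r), ← h2]
              ring
          _ ≤ κ * constC r * G y ^ beta₁ α r * (κ ^ (r * theta α r) * h ^ r) := by gcongr
          _ = _ := by
              rw [Real.rpow_add (by linarith), Real.rpow_one]
              ring
    _ = _ := lintegral_const_mul _ (by have := (hG.continuous_rpow (beta₁ α r)).measurable; fun_prop)

/-- Again with Δ ≈ h G^{-θ}: (GΔ)^α = G^α Δ^{α-1} Δ ≈ h^{α-1} G^{α+θ(1-α)} Δ. The choice of θ makes
this exponent of G equal to β₁ as well. -/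
theorem measure_cell_rpow_le (hr : 1 < r) (hα₀ : 0 < α) (hα₁ : α < 1)
    (hG : IsRegularMajorant (theta α r) g G) (huv : u < v) (hκ : 1 ≤ κ) (hh : 0 < h)
    (hslow : ∀ x ∈ Set.Icc u v, ∀ y ∈ Set.Icc u v, G x ≤ κ * G y)
    (hint : ∫ x in u..v, G x ^ theta α r = h) :
    densMeasure g (Set.Ico u v) ^ α ≤
      ENNReal.ofReal (h ^ (α - 1) * κ ^ beta₁ α r) *
        ∫⁻ x in Set.Ico u v, ENNReal.ofReal (G x ^ beta₁ α r) := by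
  have hθ := theta_pos hr hα₁
  have hΔ : 0 < v - u := by linarith
  have hκ0 : 0 < κ := by linarith
  obtain ⟨y₀, hy₀, hmin⟩ := isCompact_Icc.exists_isMinOn (Set.nonempty_Icc.2 huv.le)
    hG.continuous.continuousOn
  have hG0 := hG.pos y₀
  have hle : ∀ y ∈ Set.Icc u v, h ≤ (v - u) * (κ * G y) ^ theta α r := by
    intro y hy
    rw [← hint, ← smul_eq_mul, ← intervalIntegral.integral_const]
    refine intervalIntegral.integral_mono_on huv.le ((hG.continuous_rpow _).intervalIntegrable _ _)
      (by simp) fun x hx => ?_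
    exact Real.rpow_le_rpow (hG.pos x).le (hslow x hx y hy) hθ.le
  calc densMeasure g (Set.Ico u v) ^ α
      ≤ ENNReal.ofReal (κ * G y₀ * (v - u)) ^ α := by
        refine ENNReal.rpow_le_rpow ?_ hα₀.le
        rw [densMeasure_apply, ENNReal.ofReal_mul (by positivity), ← Real.volume_Ico,
          ← setLIntegral_const]
        refine setLIntegral_mono' measurableSet_Ico fun x hx => ENNReal.ofReal_le_ofReal ?_
        exact (hG.le x).trans (hslow x (Set.Ico_subset_Icc_self hx) y₀ hy₀)
    _ = ENNReal.ofReal ((κ * G y₀) ^ α * (v - u) ^ (α - 1)) * volume (Set.Ico u v) := by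
        rw [ENNReal.ofReal_rpow_of_pos (by positivity), Real.volume_Ico,
          ← ENNReal.ofReal_mul (by positivity), Real.mul_rpow (by positivity) hΔ.le, mul_assoc,
          ← Real.rpow_add_one hΔ.ne', sub_add_cancel]
    _ = ∫⁻ _ in Set.Ico u v, ENNReal.ofReal ((κ * G y₀) ^ α * (v - u) ^ (α - 1)) := by simp
    _ ≤ ∫⁻ y in Set.Ico u v, ENNReal.ofReal (h ^ (α - 1) * κ ^ beta₁ α r) *
          ENNReal.ofReal (G y ^ beta₁ α r) := by
        refine setLIntegral_mono' measurableSet_Ico fun y hy => ?_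
        have hy' := Set.Ico_subset_Icc_self hy
        have hGy := hG.pos y
        rw [← ENNReal.ofReal_mul (by positivity)]
        refine ENNReal.ofReal_le_ofReal ?_
        have h1 := Real.rpow_le_rpow_of_nonpos hh (hle y hy') (by linarith : α - 1 ≤ 0)
        rw [Real.mul_rpow hΔ.le (by positivity), ← Real.rpow_mul (by positivity)] at h1
        have h2 : (κ * G y) ^ α =
            (κ * G y) ^ beta₁ α r * (κ * G y) ^ (theta α r * (α - 1)) := by
          rw [← Real.rpow_add (by positivity), beta₁_eq' hr hα₁]
          ring_nf
        calc (κ * G y₀) ^ α * (v - u) ^ (α - 1) ≤ (κ * G y) ^ α * (v - u) ^ (α - 1) := by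
              gcongr
              exact hmin hy'
          _ = (κ * G y) ^ beta₁ α r * ((v - u) ^ (α - 1) * (κ * G y) ^ (theta α r * (α - 1))) := by
              rw [h2]
              ring
          _ ≤ (κ * G y) ^ beta₁ α r * h ^ (α - 1) := by gcongr
          _ = _ := by
              rw [Real.mul_rpow hκ0.le hGy.le]
              ring
    _ = _ := lintegral_const_mul _ (by have := (hG.continuous_rpow (beta₁ α r)).measurable; fun_prop)

end CellBounds

/-! ### Upper bound for the optimal distortion. -/

theorem exists_isQuantizer_le {α r : ℝ} (hr : 1 < r) (hα₀ : 0 < α) (hα₁ : α < 1)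
    {g : ℝ → ℝ} (hg : IsProbDensity g) (hgu : UpperSemicontinuous g)
    {C : ℝ} (hC : 0 < C) (hgC : ∀ x, g x ≤ C * √(1 + x ^ 2) ^ (-(1 + r)))
    {A : ℝ} (hA : ∫⁻ x, ENNReal.ofReal (g x ^ beta₁ α r) < ENNReal.ofReal A) :
    ∃ h₀ : ℝ, 0 < h₀ ∧ ∀ h, 0 < h → h < h₀ → ∃ q : ℝ → ℝ, IsQuantizer q ∧
      distortion r (densMeasure g) q ≤ ENNReal.ofReal (constC r * h ^ r * A) ∧
      cellSum α (densMeasure g) q Set.univ ≤ ENNReal.ofReal (h ^ (α - 1) * A) := by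
  obtain ⟨G, hG, hGA⟩ := exists_isRegularMajorant hr hα₀ hα₁ hg.nonneg hgu hC hgC hA
  have hCr := constC_pos hr
  set B : ℝ := (∫⁻ x, ENNReal.ofReal (G x ^ beta₁ α r)).toReal with hB
  have hBtop : ∫⁻ x, ENNReal.ofReal (G x ^ beta₁ α r) = ENNReal.ofReal B :=
    (ENNReal.ofReal_toReal hGA.ne_top).symm
  have hB0 : 0 ≤ B := ENNReal.toReal_nonneg
  have hBA : B < A := by
    rw [hBtop] at hGA
    exact (ENNReal.ofReal_lt_ofReal_iff_of_nonneg hB0).1 hGA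
  have hκ : ∀ p : ℝ, ∀ᶠ κ in 𝓝[>] (1 : ℝ), κ ^ p * B < A := fun p => by
    have hc : ContinuousAt (fun κ : ℝ => κ ^ p * B) 1 :=
      (Real.continuousAt_rpow_const _ _ (Or.inl one_ne_zero)).mul continuousAt_const
    refine (hc.eventually_lt_const ?_).filter_mono nhdsWithin_le_nhds
    simpa using hBA
  obtain ⟨κ, ⟨hκ1, hκ2⟩, hκ3⟩ := (((hκ (1 + r * theta α r)).and (hκ (beta₁ α r))).and
    self_mem_nhdsWithin).exists
  have hκ1' : 1 < κ := hκ3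
  obtain ⟨δ, hδ, hslow⟩ := hG.slow κ hκ1'
  obtain ⟨c, hc, hars⟩ := hG.exists_arsinh_le
  -- The integral h of G^θ over a cell is at least c times the arsinh-length of the cell, so h < cδ
  -- makes that length less than δ.
  refine ⟨c * δ, by positivity, fun h hh hlt => ?_⟩
  obtain ⟨e, he⟩ := hG.exists_orderIso hh
  have hcell : ∀ k : ℤ, ∫ x in (e.symm k)..(e.symm (k + 1)), G x ^ theta α r = h := fun k => by
    rw [he, e.apply_symm_apply, e.apply_symm_apply]
    ring
  have hs : ∀ k : ℤ, ∀ x ∈ Set.Icc (e.symm (k : ℝ)) (e.symm (k + 1)),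
      ∀ y ∈ Set.Icc (e.symm (k : ℝ)) (e.symm (k + 1)), G x ≤ κ * G y := by
    intro k x hx y hy
    apply hslow
    have h1 := hars _ _ (symm_lt_symm_add_one e k).le
    rw [hcell] at h1
    have hx1 := Real.arsinh_le_arsinh.2 hx.1
    have hx2 := Real.arsinh_le_arsinh.2 hx.2
    have hy1 := Real.arsinh_le_arsinh.2 hy.1
    have hy2 := Real.arsinh_le_arsinh.2 hy.2
    have h2 := lt_of_mul_lt_mul_left (h1.trans_lt hlt) hc.le
    rw [abs_lt]
    constructor <;> linarith
  refine ⟨companding e, isQuantizer_companding e, ?_, ?_⟩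
  · calc distortion r (densMeasure g) (companding e)
        = ∑' k, ∫⁻ x in compandingCell e k,
            ENNReal.ofReal (|x - companding e x| ^ r) ∂(densMeasure g) :=
          lintegral_eq_tsum_compandingCell e _ _
      _ ≤ ∑' k, ENNReal.ofReal (constC r * h ^ r * κ ^ (1 + r * theta α r)) *
            ∫⁻ x in compandingCell e k, ENNReal.ofReal (G x ^ beta₁ α r) := by
          refine ENNReal.tsum_le_tsum fun k => ?_
          refine le_trans (le_of_eq ?_) (distortion_cell_le hr hα₁ hg hG
            (symm_lt_symm_add_one e k) hκ1'.le (hs k) (hcell k))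
          refine setLIntegral_congr_fun measurableSet_Ico fun x hx => ?_
          have : ⌊e x⌋ = k := (mem_compandingCell e).1 hx
          simp only [companding, this, compandingPoint]
      _ = ENNReal.ofReal (constC r * h ^ r * (κ ^ (1 + r * theta α r) * B)) := by
          rw [ENNReal.tsum_mul_left, ← lintegral_eq_tsum_compandingCell, hBtop,
            ← ENNReal.ofReal_mul (by positivity), mul_assoc]
      _ ≤ _ := by gcongr
  · calc cellSum α (densMeasure g) (companding e) Set.univ
        = ∑' k, densMeasure g (compandingCell e k) ^ α := cellSum_companding e _ _
      _ ≤ ∑' k, ENNReal.ofReal (h ^ (α - 1) * κ ^ beta₁ α r) *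
            ∫⁻ x in compandingCell e k, ENNReal.ofReal (G x ^ beta₁ α r) :=
          ENNReal.tsum_le_tsum fun k => measure_cell_rpow_le hr hα₀ hα₁ hG
            (symm_lt_symm_add_one e k) hκ1'.le hh (hs k) (hcell k)
      _ = ENNReal.ofReal (h ^ (α - 1) * (κ ^ beta₁ α r * B)) := by
          rw [ENNReal.tsum_mul_left, ← lintegral_eq_tsum_compandingCell, hBtop,
            ← ENNReal.ofReal_mul (by positivity), mul_assoc]
      _ ≤ _ := by gcongr

theorem optDistortion_renyiEntropy_le {α r : ℝ} (hα₁ : α < 1) {μ : Measure ℝ} {p q : ℝ → ℝ}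
    (hp : IsQuantizer p) (hpq : cellSum α μ p Set.univ ≤ cellSum α μ q Set.univ) :
    optDistortion α r μ (renyiEntropy α μ q) ≤ distortion r μ p := by
  refine iInf₂_le p ⟨hp, ?_⟩
  rw [renyiEntropy_eq, renyiEntropy_eq]
  refine mul_le_mul_of_nonneg_left (ENNReal.log_le_log hpq) ?_
  exact_mod_cast (one_div_pos.2 (sub_pos.2 hα₁)).le

section UpperBound

variable {α r : ℝ} {g : ℝ → ℝ} {C A : ℝ}

/-- Infinite entropy imposes no constraint, so companding with h → 0 is allowed. This later excludes
infinite entropy along asymptotically optimal sequences. -/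
theorem optDistortion_eq_zero_of_cellSum_eq_top (hr : 1 < r) (hα₀ : 0 < α) (hα₁ : α < 1)
    (hg : IsProbDensity g) (hgu : UpperSemicontinuous g)
    (hC : 0 < C) (hgC : ∀ x, g x ≤ C * √(1 + x ^ 2) ^ (-(1 + r)))
    (hA : ∫⁻ x, ENNReal.ofReal (g x ^ beta₁ α r) < ENNReal.ofReal A)
    {q : ℝ → ℝ} (hq : cellSum α (densMeasure g) q Set.univ = ⊤) :
    optDistortion α r (densMeasure g) (renyiEntropy α (densMeasure g) q) = 0 := by
  obtain ⟨h₀, hh₀, H⟩ := exists_isQuantizer_le hr hα₀ hα₁ hg hgu hC hgC hA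
  refine le_antisymm ?_ zero_le
  have hlim : Tendsto (fun h : ℝ => ENNReal.ofReal (constC r * h ^ r * A)) (𝓝[>] 0) (𝓝 0) := by
    have hc : ContinuousAt (fun h : ℝ => constC r * h ^ r * A) 0 :=
      (continuousAt_const.mul (Real.continuousAt_rpow_const _ _ (Or.inr (by linarith)))).mul
        continuousAt_const
    have := ENNReal.tendsto_ofReal (hc.tendsto.mono_left (nhdsWithin_le_nhds (s := Set.Ioi 0)))
    simpa [Real.zero_rpow (by linarith : r ≠ 0)] using this
  refine ge_of_tendsto hlim ?_
  filter_upwards [Ioo_mem_nhdsGT hh₀] with h hh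
  obtain ⟨p, hp, hpD, -⟩ := H h hh.1 hh.2
  exact (optDistortion_renyiEntropy_le hα₁ hp (by rw [hq]; exact le_top)).trans hpD

theorem exists_optDistortion_le (hr : 1 < r) (hα₀ : 0 < α) (hα₁ : α < 1)
    (hg : IsProbDensity g) (hgu : UpperSemicontinuous g)
    (hC : 0 < C) (hgC : ∀ x, g x ≤ C * √(1 + x ^ 2) ^ (-(1 + r)))
    (hA0 : 0 < A) (hA : ∫⁻ x, ENNReal.ofReal (g x ^ beta₁ α r) < ENNReal.ofReal A) :
    ∃ s₀ : ℝ, 0 < s₀ ∧ ∀ (q : ℝ → ℝ) (s : ℝ), s₀ < s →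
      cellSum α (densMeasure g) q Set.univ = ENNReal.ofReal s →
      optDistortion α r (densMeasure g) (renyiEntropy α (densMeasure g) q) ≤
        ENNReal.ofReal (constC r * A * (A / s) ^ (r / (1 - α))) := by
  obtain ⟨h₀, hh₀, H⟩ := exists_isQuantizer_le hr hα₀ hα₁ hg hgu hC hgC hA
  have hα : 0 < 1 - α := by linarith
  -- The step is h = (A/s)^{1/(1-α)}, the solution of h^{α-1} A = s; s larger than this threshold
  -- means h < h₀.
  refine ⟨A / h₀ ^ (1 - α), by positivity, fun q s hs hq => ?_⟩
  have hs0 : 0 < s := lt_trans (by positivity) hs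
  have hlt : (A / s) ^ (1 / (1 - α)) < h₀ := by
    rw [one_div, Real.rpow_inv_lt_iff_of_pos (by positivity) hh₀.le hα]
    rw [div_lt_iff₀ (by positivity)] at hs ⊢
    linarith
  obtain ⟨p, hp, hpD, hpS⟩ := H ((A / s) ^ (1 / (1 - α))) (by positivity) hlt
  refine (optDistortion_renyiEntropy_le hα₁ hp (hpS.trans (le_of_eq ?_))).trans
    (hpD.trans (le_of_eq ?_))
  · rw [hq, ← Real.rpow_mul (by positivity),
      show 1 / (1 - α) * (α - 1) = -1 by field_simp; ring, Real.rpow_neg_one]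
    congr 1
    field_simp
  · rw [← Real.rpow_mul (by positivity), show 1 / (1 - α) * r = r / (1 - α) by ring]
    ring_nf

end UpperBound

/-! ### Lower bound: moment inequality on cells and Hölder over cells. -/

theorem tsum_rpow_mul_rpow_le {ι : Type*} [Countable ι] (f g : ι → ℝ≥0∞) {p q : ℝ} (hp : 0 ≤ p)
    (hq : 0 ≤ q) (hpq : p + q = 1) :
    ∑' i, f i ^ p * g i ^ q ≤ (∑' i, f i) ^ p * (∑' i, g i) ^ q := by
  let _ : MeasurableSpace ι := ⊤
  have := ENNReal.lintegral_mul_norm_pow_le (μ := Measure.count) (f := f) (g := g)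
    (measurable_of_countable f).aemeasurable (measurable_of_countable g).aemeasurable hp hq hpq
  simpa only [lintegral_count] using this

/-- Among the sets of given Lebesgue measure, an interval centered at `a` has the smallest
`r`th moment about `a`. -/
theorem le_lintegral_abs_sub_rpow {r : ℝ} (hr : 1 < r) (a : ℝ) {Δ : ℝ} (hΔ : 0 ≤ Δ) {J : Set ℝ}
    (hJ : MeasurableSet J) (hvol : volume J = ENNReal.ofReal Δ) :
    ENNReal.ofReal (constC r * Δ ^ (1 + r)) ≤ ∫⁻ x in J, ENNReal.ofReal (|x - a| ^ r) := by
  set B := Set.Icc (a - Δ / 2) (a + Δ / 2) with hB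
  have hBm : MeasurableSet B := measurableSet_Icc
  have hBvol : volume B = ENNReal.ofReal Δ := by
    rw [hB, Real.volume_Icc]
    ring_nf
  -- Exchange argument: B \ J and J \ B have equal volume, and the integrand is at most (Δ/2)^r on
  -- the first and at least that on the second.
  have hdiff : volume (B \ J) = volume (J \ B) := by
    have h1 := measure_inter_add_sdiff (μ := volume) B hJ
    have h2 := measure_inter_add_sdiff (μ := volume) J hBm
    rw [hBvol, ← hvol, ← h2, Set.inter_comm J B] at h1
    refine (ENNReal.add_right_inj ?_).1 h1
    exact measure_ne_top_of_subset Set.inter_subset_left (by rw [hBvol]; exact ENNReal.ofReal_ne_top)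
  rw [← lintegral_abs_sub_rpow hr a hΔ, ← lintegral_inter_add_sdiff _ B hJ,
    ← lintegral_inter_add_sdiff _ J hBm, Set.inter_comm J B]
  refine add_le_add le_rfl ?_
  calc ∫⁻ x in B \ J, ENNReal.ofReal (|x - a| ^ r)
      ≤ ∫⁻ _ in B \ J, ENNReal.ofReal ((Δ / 2) ^ r) := by
        refine setLIntegral_mono' (hBm.diff hJ) fun x hx => ENNReal.ofReal_le_ofReal ?_
        refine Real.rpow_le_rpow (abs_nonneg _) ?_ (by linarith)
        rw [abs_le]
        constructor <;> linarith [hx.1.1, hx.1.2]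
    _ = ∫⁻ _ in J \ B, ENNReal.ofReal ((Δ / 2) ^ r) := by
        rw [setLIntegral_const, setLIntegral_const, hdiff]
    _ ≤ ∫⁻ x in J \ B, ENNReal.ofReal (|x - a| ^ r) := by
        refine setLIntegral_mono' (hJ.diff hBm) fun x hx => ENNReal.ofReal_le_ofReal ?_
        refine Real.rpow_le_rpow (by positivity) ?_ (by linarith)
        by_contra! hlt
        rw [abs_lt] at hlt
        exact hx.2 ⟨by linarith [hlt.1], by linarith [hlt.2]⟩

theorem mul_constC_mul_rpow_le {r : ℝ} (hr : 1 < r) (a : ℝ) {Δ m : ℝ} (hΔ : 0 ≤ Δ) (hm : 0 ≤ m)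
    {g : ℝ → ℝ} (hg : Measurable g) {J : Set ℝ} (hJ : MeasurableSet J)
    (hvol : volume J = ENNReal.ofReal Δ) (hmg : ∀ x ∈ J, m ≤ g x) :
    ENNReal.ofReal (m * (constC r * Δ ^ (1 + r))) ≤
      ∫⁻ x in J, ENNReal.ofReal (|x - a| ^ r) ∂(densMeasure g) := by
  rw [lintegral_densMeasure hg hJ (by fun_prop), ENNReal.ofReal_mul hm]
  calc _ ≤ ENNReal.ofReal m * ∫⁻ x in J, ENNReal.ofReal (|x - a| ^ r) := by
        gcongr
        exact le_lintegral_abs_sub_rpow hr a hΔ hJ hvol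
    _ = ∫⁻ x in J, ENNReal.ofReal m * ENNReal.ofReal (|x - a| ^ r) :=
        (lintegral_const_mul _ (by fun_prop)).symm
    _ ≤ _ := setLIntegral_mono' hJ fun x hx => by
        gcongr
        exact hmg x hx

section LowerBound

variable {α r : ℝ} {g : ℝ → ℝ}

/-- If g ≥ m on J and J has length Δ, then D_J/C ≥ m Δ^{1+r} and μ(J) ≥ mΔ; the weights θ and 1-θ
combine these to exactly m^β₁ Δ. Since m = g y / κ, g is at most κ² m, whence the factor κ^{2β₁}. -/
theorem lintegral_rpow_cell_le (hr : 1 < r) (hα₀ : 0 < α) (hα₁ : α < 1) (hg : Measurable g)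
    (a : ℝ) {κ : ℝ} (hκ : 1 ≤ κ) {J : Set ℝ} (hJ : MeasurableSet J) (hJfin : volume J ≠ ⊤)
    (hpos : ∀ x ∈ J, 0 < g x) (hslow : ∀ x ∈ J, ∀ y ∈ J, g x ≤ κ * g y) :
    ∫⁻ x in J, ENNReal.ofReal (g x ^ beta₁ α r) ≤ ENNReal.ofReal (κ ^ (2 * beta₁ α r)) *
      (((∫⁻ x in J, ENNReal.ofReal (|x - a| ^ r) ∂(densMeasure g)) / ENNReal.ofReal (constC r)) ^
        theta α r * (densMeasure g J ^ α) ^ (1 - theta α r)) := by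
  have hC := constC_pos hr
  have hθ := theta_pos hr hα₁
  have hθ1 := theta_lt_one hr hα₁
  have hβ := beta₁_pos hr hα₀ hα₁
  have hκ0 : 0 < κ := by linarith
  rcases eq_or_ne (volume J) 0 with h0 | h0
  · rw [setLIntegral_measure_zero _ _ h0]
    exact zero_le
  obtain ⟨y, hy⟩ : J.Nonempty := nonempty_of_measure_ne_zero h0
  set Δ := (volume J).toReal with hΔ
  have hvol : volume J = ENNReal.ofReal Δ := (ENNReal.ofReal_toReal hJfin).symm
  have hΔ0 : 0 < Δ := ENNReal.toReal_pos h0 hJfin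
  set m := g y / κ with hm
  have hm0 : 0 < m := div_pos (hpos y hy) hκ0
  have hmg : ∀ x ∈ J, m ≤ g x := fun x hx => by
    rw [hm, div_le_iff₀ hκ0, mul_comm]
    exact hslow y hy x hx
  have hgm : ∀ x ∈ J, g x ≤ κ ^ (2 : ℝ) * m := fun x hx => by
    have : κ ^ (2 : ℝ) * m = κ * g y := by
      rw [hm, Real.rpow_two]
      field_simp
    rw [this]
    exact hslow x hx y hy
  have h1 : ∫⁻ x in J, ENNReal.ofReal (g x ^ beta₁ α r) ≤
      ENNReal.ofReal (κ ^ (2 * beta₁ α r)) * ENNReal.ofReal (m ^ beta₁ α r * Δ) := by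
    calc ∫⁻ x in J, ENNReal.ofReal (g x ^ beta₁ α r)
        ≤ ∫⁻ _ in J, ENNReal.ofReal ((κ ^ (2 : ℝ) * m) ^ beta₁ α r) :=
          setLIntegral_mono' hJ fun x hx => ENNReal.ofReal_le_ofReal
            (Real.rpow_le_rpow (hpos x hx).le (hgm x hx) hβ.le)
      _ = _ := by
          rw [setLIntegral_const, hvol, Real.mul_rpow (by positivity) hm0.le,
            ← Real.rpow_mul hκ0.le, ← ENNReal.ofReal_mul (by positivity),
            ← ENNReal.ofReal_mul (by positivity), mul_assoc]
  refine h1.trans (mul_le_mul_right ?_ _)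
  have hD : ENNReal.ofReal (m * Δ ^ (1 + r)) ≤
      (∫⁻ x in J, ENNReal.ofReal (|x - a| ^ r) ∂(densMeasure g)) / ENNReal.ofReal (constC r) := by
    rw [ENNReal.le_div_iff_mul_le (Or.inl (by simpa using hC)) (Or.inl ENNReal.ofReal_ne_top),
      ← ENNReal.ofReal_mul (by positivity)]
    refine le_trans (le_of_eq ?_) (mul_constC_mul_rpow_le hr a hΔ0.le hm0.le hg hJ hvol hmg)
    ring_nf
  have hS : ENNReal.ofReal (m * Δ) ≤ densMeasure g J := by
    rw [densMeasure_apply, ENNReal.ofReal_mul hm0.le, ← hvol, ← setLIntegral_const]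
    exact setLIntegral_mono' hJ fun x hx => ENNReal.ofReal_le_ofReal (hmg x hx)
  refine le_trans (le_of_eq ?_) (mul_le_mul' (ENNReal.rpow_le_rpow hD hθ.le)
    (ENNReal.rpow_le_rpow (ENNReal.rpow_le_rpow hS hα₀.le) (by linarith)))
  rw [ENNReal.ofReal_rpow_of_pos (by positivity), ENNReal.ofReal_rpow_of_pos (by positivity),
    ENNReal.ofReal_rpow_of_pos (by positivity), ← ENNReal.ofReal_mul (by positivity),
    Real.mul_rpow hm0.le (by positivity), ← Real.rpow_mul (by positivity),
    ← Real.rpow_mul (by positivity), Real.mul_rpow hm0.le hΔ0.le]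
  congr 1
  have e1 : beta₁ α r = theta α r + α * (1 - theta α r) := by
    rw [beta₁_eq' hr hα₁]
    ring
  have e2 : (1 + r) * theta α r + α * (1 - theta α r) = 1 := by
    have h := beta₁_eq (α := α) hr hα₁
    rw [beta₁_eq' hr hα₁] at h
    linarith
  calc m ^ beta₁ α r * Δ = m ^ (theta α r + α * (1 - theta α r)) *
        Δ ^ ((1 + r) * theta α r + α * (1 - theta α r)) := by rw [← e1, e2, Real.rpow_one]
    _ = _ := by
        rw [Real.rpow_add hm0, Real.rpow_add hΔ0]
        ring

theorem IsQuantizer.measurableSet_preimage {q : ℝ → ℝ} (hq : IsQuantizer q) (a : ℝ) :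
    MeasurableSet (q ⁻¹' {a}) := hq.measurable (measurableSet_singleton a)

theorem IsQuantizer.lintegral_eq_tsum {q : ℝ → ℝ} (hq : IsQuantizer q) (μ : Measure ℝ)
    {E : Set ℝ} (hE : MeasurableSet E) (f : ℝ → ℝ≥0∞) :
    ∫⁻ x in E, f x ∂μ = ∑' a : Set.range q, ∫⁻ x in q ⁻¹' {(a : ℝ)} ∩ E, f x ∂μ := by
  have : Countable (Set.range q) := hq.countable_range.to_subtype
  have hU : ⋃ a : Set.range q, q ⁻¹' {(a : ℝ)} ∩ E = E := by
    ext x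
    simp
  conv_lhs => rw [← hU]
  refine lintegral_iUnion (fun a : Set.range q => (hq.measurableSet_preimage a).inter hE) ?_ f
  intro a b hab
  refine Set.disjoint_left.2 fun x hx hx' => hab (Subtype.ext ?_)
  exact (Set.mem_singleton_iff.1 hx.1).symm.trans (Set.mem_singleton_iff.1 hx'.1)

/-- Small distortion forces the cells to be short on [a, b] ∩ I, where g ≥ l. Uniform continuity
with tolerance (κ-1)l ≤ (κ-1) g y then gives g x ≤ κ g y within each trace, so the one-cell bounds
hold and can be summed by Hölder. -/
theorem exists_lintegral_rpow_le (hr : 1 < r) (hα₀ : 0 < α) (hα₁ : α < 1) (hg : Measurable g)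
    {a b l : ℝ} (hl : 0 < l) (hlg : ∀ x ∈ Set.Icc a b, l ≤ g x)
    (hgc : ContinuousOn g (Set.Icc a b)) {I : Set ℝ} (hI : MeasurableSet I)
    (hIo : I.OrdConnected) {κ : ℝ} (hκ : 1 < κ) :
    ∃ η : ℝ, 0 < η ∧ ∀ q : ℝ → ℝ, IsQuantizer q →
      distortion r (densMeasure g) q < ENNReal.ofReal η →
      ∫⁻ x in Set.Icc a b ∩ I, ENNReal.ofReal (g x ^ beta₁ α r) ≤
        ENNReal.ofReal (κ ^ (2 * beta₁ α r)) *
        ((distortionOn r (densMeasure g) q I / ENNReal.ofReal (constC r)) ^ theta α r *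
          cellSum α (densMeasure g) q I ^ (1 - theta α r)) := by
  have hC := constC_pos hr
  have hθ := theta_pos hr hα₁
  have hθ1 := theta_lt_one hr hα₁
  obtain ⟨δ, hδ, hunif⟩ := Metric.uniformContinuousOn_iff.1
    (isCompact_Icc.uniformContinuousOn_of_continuous hgc) ((κ - 1) * l)
    (mul_pos (by linarith) hl)
  -- This is the least distortion that an interval of length δ inside one cell can cause where g ≥
  -- l.
  refine ⟨l * (constC r * δ ^ (1 + r)), by positivity, fun q hq hDq => ?_⟩
  have : Countable (Set.range q) := hq.countable_range.to_subtype
  set K := Set.Icc a b ∩ I with hK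
  have hKm : MeasurableSet K := measurableSet_Icc.inter hI
  have hKo : K.OrdConnected := Set.ordConnected_Icc.inter hIo
  have hKfin : volume K ≠ ⊤ := measure_ne_top_of_subset Set.inter_subset_left (by simp)
  have hcell : ∀ c ∈ Set.range q, (q ⁻¹' {c}).OrdConnected := by
    rintro _ ⟨x, rfl⟩
    exact hq.ordConnected x
  have hlen : ∀ c ∈ Set.range q, ∀ x ∈ q ⁻¹' {c} ∩ K, ∀ y ∈ q ⁻¹' {c} ∩ K, y - x < δ := by
    intro c hc x hx y hy
    by_contra! hge
    have hxy : 0 ≤ y - x := hδ.le.trans hge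
    have hsub : Set.Icc x y ⊆ q ⁻¹' {c} ∩ K := ((hcell c hc).inter hKo).out hx hy
    refine hDq.not_ge ?_
    calc ENNReal.ofReal (l * (constC r * δ ^ (1 + r)))
        ≤ ENNReal.ofReal (l * (constC r * (y - x) ^ (1 + r))) := by gcongr
      _ ≤ ∫⁻ t in Set.Icc x y, ENNReal.ofReal (|t - c| ^ r) ∂(densMeasure g) :=
          mul_constC_mul_rpow_le hr c hxy hl.le hg measurableSet_Icc Real.volume_Icc
            fun t ht => hlg t (hsub ht).2.1
      _ = ∫⁻ t in Set.Icc x y, ENNReal.ofReal (|t - q t| ^ r) ∂(densMeasure g) := by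
          refine setLIntegral_congr_fun measurableSet_Icc fun t ht => ?_
          have : q t = c := (hsub ht).1
          simp only [this]
      _ ≤ distortion r (densMeasure g) q := setLIntegral_le_lintegral _ _
  have hslow : ∀ c ∈ Set.range q, ∀ x ∈ q ⁻¹' {c} ∩ K, ∀ y ∈ q ⁻¹' {c} ∩ K,
      g x ≤ κ * g y := by
    intro c hc x hx y hy
    have h1 := hunif x hx.2.1 y hy.2.1 (by
      rw [Real.dist_eq, abs_lt]
      constructor <;> linarith [hlen c hc x hx y hy, hlen c hc y hy x hx])
    rw [Real.dist_eq] at h1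
    have h2 := mul_le_mul_of_nonneg_left (hlg y hy.2.1) (by linarith : 0 ≤ κ - 1)
    linarith [le_abs_self (g x - g y)]
  calc ∫⁻ x in K, ENNReal.ofReal (g x ^ beta₁ α r)
      = ∑' c : Set.range q, ∫⁻ x in q ⁻¹' {(c : ℝ)} ∩ K, ENNReal.ofReal (g x ^ beta₁ α r) :=
        hq.lintegral_eq_tsum _ hKm _
    _ ≤ ∑' c : Set.range q, ENNReal.ofReal (κ ^ (2 * beta₁ α r)) *
          (((∫⁻ x in q ⁻¹' {(c : ℝ)} ∩ K, ENNReal.ofReal (|x - c| ^ r) ∂(densMeasure g)) /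
            ENNReal.ofReal (constC r)) ^ theta α r *
          (densMeasure g (q ⁻¹' {(c : ℝ)} ∩ K) ^ α) ^ (1 - theta α r)) := by
        refine ENNReal.tsum_le_tsum fun c => ?_
        exact lintegral_rpow_cell_le hr hα₀ hα₁ hg c hκ.le
          ((hq.measurableSet_preimage c).inter hKm)
          (measure_ne_top_of_subset Set.inter_subset_right hKfin)
          (fun x hx => hl.trans_le (hlg x hx.2.1)) (hslow c c.2)
    _ ≤ ENNReal.ofReal (κ ^ (2 * beta₁ α r)) *
          ((∑' c : Set.range q, (∫⁻ x in q ⁻¹' {(c : ℝ)} ∩ K,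
            ENNReal.ofReal (|x - c| ^ r) ∂(densMeasure g)) / ENNReal.ofReal (constC r)) ^ theta α r *
          (∑' c : Set.range q, densMeasure g (q ⁻¹' {(c : ℝ)} ∩ K) ^ α) ^ (1 - theta α r)) := by
        rw [ENNReal.tsum_mul_left]
        gcongr
        exact tsum_rpow_mul_rpow_le _ _ hθ.le (by linarith) (by ring)
    _ ≤ _ := by
        gcongr
        · simp_rw [div_eq_mul_inv]
          rw [ENNReal.tsum_mul_right]
          gcongr
          calc ∑' c : Set.range q, ∫⁻ x in q ⁻¹' {(c : ℝ)} ∩ K,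
                ENNReal.ofReal (|x - c| ^ r) ∂(densMeasure g)
              = ∑' c : Set.range q, ∫⁻ x in q ⁻¹' {(c : ℝ)} ∩ K,
                ENNReal.ofReal (|x - q x| ^ r) ∂(densMeasure g) := by
                refine tsum_congr fun c => ?_
                refine setLIntegral_congr_fun ((hq.measurableSet_preimage c).inter hKm)
                  fun x hx => ?_
                have : q x = c := hx.1
                simp only [this]
            _ = ∫⁻ x in K, ENNReal.ofReal (|x - q x| ^ r) ∂(densMeasure g) :=
                (hq.lintegral_eq_tsum _ hKm _).symm
            _ ≤ distortionOn r (densMeasure g) q I := lintegral_mono_set Set.inter_subset_right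
        · refine ENNReal.tsum_le_tsum fun c => ?_
          gcongr
          exact Set.inter_subset_right

/-- The superlevel intervals exhaust {g > 0}, so by monotone convergence one of them captures more
than A of the integral over I; the strict gap also absorbs the factor κ^{2β₁} for κ near 1. -/
theorem IsWeaklyUnimodal.exists_le_distortionOn_mul_cellSum (hr : 1 < r) (hα₀ : 0 < α)
    (hα₁ : α < 1) (hg : IsWeaklyUnimodal g) {I : Set ℝ} (hI : MeasurableSet I)
    (hIo : I.OrdConnected) {A : ℝ≥0∞} (hA : A < ∫⁻ x in I, ENNReal.ofReal (g x ^ beta₁ α r)) :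
    ∃ η : ℝ, 0 < η ∧ ∀ q : ℝ → ℝ, IsQuantizer q →
      distortion r (densMeasure g) q < ENNReal.ofReal η →
      A ≤ (distortionOn r (densMeasure g) q I / ENNReal.ofReal (constC r)) ^ theta α r *
          cellSum α (densMeasure g) q I ^ (1 - theta α r) := by
  have hβ := beta₁_pos hr hα₀ hα₁
  have hgm := hg.measurable
  obtain ⟨l₁, hl₁, H⟩ := hg.exists_superlevel
  set f : ℝ → ℝ≥0∞ := fun x => ENNReal.ofReal (g x ^ beta₁ α r) with hf
  set s : ℕ → Set ℝ := fun n => {x | l₁ / (n + 1) ≤ g x} with hs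
  have hsm : ∀ n, MeasurableSet (s n) := fun n => measurableSet_le measurable_const hgm
  have hlim : Tendsto (fun n => ∫⁻ x in I, (s n).indicator f x) atTop (𝓝 (∫⁻ x in I, f x)) := by
    refine lintegral_tendsto_of_tendsto_of_monotone
      (fun n => (Measurable.indicator (by fun_prop) (hsm n)).aemeasurable)
      (Eventually.of_forall fun x m n hmn => ?_) (Eventually.of_forall fun x => ?_)
    · refine Set.indicator_le_indicator_apply_of_subset (fun y hy => ?_) (zero_le (a := f x))
      have : (m : ℝ) ≤ n := by exact_mod_cast hmn
      have hle : l₁ / ((n : ℝ) + 1) ≤ l₁ / (m + 1) := by gcongr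
      exact hle.trans hy
    · rcases (hg.nonneg x).eq_or_lt with h0 | h0
      · have : f x = 0 := by simp [hf, ← h0, Real.zero_rpow hβ.ne']
        have h2 : ∀ n, (s n).indicator f x = f x := fun n => by
          rw [Set.indicator_apply_eq_self]
          exact fun _ => this
        simp_rw [h2]
        exact tendsto_const_nhds
      · obtain ⟨N, hN⟩ := exists_nat_gt (l₁ / g x)
        refine tendsto_const_nhds.congr' ?_
        filter_upwards [eventually_ge_atTop N] with n hn
        refine (Set.indicator_of_mem ?_ f).symm
        have hnN : (N : ℝ) ≤ n := by exact_mod_cast hn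
        change l₁ / (n + 1) ≤ g x
        rw [div_le_iff₀ (by positivity)]
        rw [div_lt_iff₀ h0] at hN
        nlinarith
  obtain ⟨n, hn⟩ := (hlim.eventually_const_lt hA).exists
  obtain ⟨a, b, -, hK, hsub⟩ := H (l₁ / (n + 1)) (by positivity)
    (div_le_self hl₁.le (by linarith [n.cast_nonneg (α := ℝ)]))
  have hsn : s n = Set.Icc a b := hK
  rw [lintegral_indicator (hsm n), Measure.restrict_restrict (hsm n), hsn] at hn
  have hκ : ∀ᶠ κ in 𝓝[>] (1 : ℝ), ENNReal.ofReal (κ ^ (2 * beta₁ α r)) * A <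
      ∫⁻ x in Set.Icc a b ∩ I, f x := by
    have hc : ContinuousAt (fun κ : ℝ => ENNReal.ofReal (κ ^ (2 * beta₁ α r))) 1 :=
      ENNReal.continuous_ofReal.continuousAt.comp
        (Real.continuousAt_rpow_const _ _ (Or.inl one_ne_zero))
    have ht := ENNReal.Tendsto.mul_const (b := A) hc.tendsto (Or.inr hA.ne_top)
    rw [Real.one_rpow, ENNReal.ofReal_one, one_mul] at ht
    exact (ht.eventually_lt_const hn).filter_mono nhdsWithin_le_nhds
  obtain ⟨κ, hκ1, hκ2⟩ := (hκ.and self_mem_nhdsWithin).exists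
  have hκ2' : 1 < κ := hκ2
  obtain ⟨η, hη, Hη⟩ := exists_lintegral_rpow_le hr hα₀ hα₁ hgm
    (show 0 < l₁ / ((n : ℝ) + 1) by positivity) (fun x hx => by rw [← hsn] at hx; exact hx)
    (hg.continuousOn_support.mono hsub) hI hIo hκ2'
  refine ⟨η, hη, fun q hq hD => ?_⟩
  have h1 := hκ1.le.trans (Hη q hq hD)
  have hpos : 0 < κ ^ (2 * beta₁ α r) := by positivity
  exact (ENNReal.mul_le_mul_iff_right (by simpa using hpos) ENNReal.ofReal_ne_top).1 h1

end LowerBound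

/-! ### Cutting at a point and stability of Hölder's inequality. -/

/-- Cells are intervals, so only the cell containing c can meet both half lines; counting it twice
costs at most 1. -/
theorem cellSum_Iic_add_cellSum_Ioi_le {α : ℝ} (hα₀ : 0 < α) (μ : Measure ℝ)
    [IsProbabilityMeasure μ] {q : ℝ → ℝ} (hq : IsQuantizer q) (c : ℝ) :
    cellSum α μ q (Set.Iic c) + cellSum α μ q (Set.Ioi c) ≤ cellSum α μ q Set.univ + 1 := by
  classical
  have h1 : (1 : ℝ≥0∞) = ∑' a : Set.range q, if a = ⟨q c, c, rfl⟩ then 1 else 0 := by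
    rw [tsum_ite_eq]
  rw [h1, cellSum, cellSum, cellSum, ← ENNReal.tsum_add, ← ENNReal.tsum_add]
  refine ENNReal.tsum_le_tsum fun a => ?_
  have hle : ∀ s : Set ℝ, μ (q ⁻¹' {(a : ℝ)} ∩ s) ^ α ≤ μ (q ⁻¹' {(a : ℝ)} ∩ Set.univ) ^ α :=
    fun s => ENNReal.rpow_le_rpow (measure_mono (by gcongr; exact Set.subset_univ s)) hα₀.le
  by_cases ha : a = ⟨q c, c, rfl⟩
  · rw [if_pos ha]
    refine add_le_add (hle _) ?_
    exact ENNReal.rpow_le_one prob_le_one hα₀.le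
  · rw [if_neg ha, add_zero]
    have hc : c ∉ q ⁻¹' {(a : ℝ)} := fun hc => ha (Subtype.ext hc.symm)
    obtain ⟨_, z, rfl⟩ := a
    rcases le_total z c with hz | hz
    · have : q ⁻¹' {q z} ∩ Set.Ioi c = ∅ := by
        refine Set.eq_empty_of_forall_notMem fun y hy => hc ?_
        exact (hq.ordConnected z).out (rfl : z ∈ q ⁻¹' {q z}) hy.1 ⟨hz, hy.2.le⟩
      simp only [this, measure_empty, ENNReal.zero_rpow_of_pos hα₀, add_zero]
      exact hle _
    · have : q ⁻¹' {q z} ∩ Set.Iic c = ∅ := by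
        refine Set.eq_empty_of_forall_notMem fun y hy => hc ?_
        exact (hq.ordConnected z).out hy.1 (rfl : z ∈ q ⁻¹' {q z}) ⟨hy.2, hz⟩
      simp only [this, measure_empty, ENNReal.zero_rpow_of_pos hα₀, zero_add]
      exact hle _

theorem eq_of_rpow_mul_rpow_eq {θ x y : ℝ} (hθ0 : 0 < θ) (hθ1 : θ < 1) (hx : 0 ≤ x) (hy : 0 ≤ y)
    (h : x ^ θ * y ^ (1 - θ) = θ * x + (1 - θ) * y) : x = y := by
  have := (Real.geom_mean_eq_arith_mean_weighted_iff_of_pos Finset.univ ![θ, 1 - θ] ![x, y]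
    (by intro i _; fin_cases i <;> simp [hθ0, hθ1]) (by simp)
    (by intro i _; fin_cases i <;> simp [hx, hy])).1 (by simpa using h)
  exact this 0 (Finset.mem_univ _) 1 (Finset.mem_univ _)

/-- Stability of the equality case of the two-term Hölder inequality. -/
theorem tendsto_of_holder_eq {θ A a : ℝ} (hθ0 : 0 < θ) (hθ1 : θ < 1) (hA : 0 < A)
    {x y z P : ℕ → ℝ} (hx : ∀ᶠ n in atTop, 0 ≤ x n ∧ x n ≤ 1)
    (hy : ∀ᶠ n in atTop, 0 ≤ y n) (hz : ∀ᶠ n in atTop, 0 ≤ z n) (hP0 : ∀ᶠ n in atTop, 0 ≤ P n)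
    (hyz : ∀ ε, 0 < ε → ∀ᶠ n in atTop, y n + z n ≤ 1 + ε)
    (hP : ∀ ε, 0 < ε → ∀ᶠ n in atTop, P n ≤ A + ε)
    (h1 : ∀ ε, 0 < ε → ∀ᶠ n in atTop, a - ε ≤ P n * (x n ^ θ * y n ^ (1 - θ)))
    (h2 : ∀ ε, 0 < ε → ∀ᶠ n in atTop, A - a - ε ≤ P n * ((1 - x n) ^ θ * z n ^ (1 - θ))) :
    Tendsto x atTop (𝓝 (a / A)) ∧ Tendsto P atTop (𝓝 A) := by
  -- Along an ultrafilter all four bounded sequences converge at once, so no subsequences are needed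
  -- and only the limits must be identified.
  suffices H : ∀ U : Ultrafilter ℕ, (U : Filter ℕ) ≤ atTop →
      Tendsto x U (𝓝 (a / A)) ∧ Tendsto P U (𝓝 A) from
    ⟨tendsto_iff_ultrafilter _ _ _ |>.2 fun U hU => (H U hU).1,
      tendsto_iff_ultrafilter _ _ _ |>.2 fun U hU => (H U hU).2⟩
  intro U hU
  have hlim : ∀ (f : ℕ → ℝ) (b : ℝ), (∀ᶠ n in atTop, f n ∈ Set.Icc 0 b) →
      ∃ t ∈ Set.Icc 0 b, Tendsto f U (𝓝 t) := fun f b hf =>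
    isCompact_Icc.ultrafilter_le_nhds' (U.map f) (hf.filter_mono hU)
  obtain ⟨x', hx', hxt⟩ := hlim x 1 hx
  obtain ⟨y', hy', hyt⟩ := hlim y 2 (by
    filter_upwards [hy, hz, hyz 1 one_pos] with n h1 h2 h3
    exact ⟨h1, by linarith⟩)
  obtain ⟨z', hz', hzt⟩ := hlim z 2 (by
    filter_upwards [hy, hz, hyz 1 one_pos] with n h1 h2 h3
    exact ⟨h2, by linarith⟩)
  obtain ⟨P', hP', hPt⟩ := hlim P (A + 1) (hP0.and (hP 1 one_pos))
  have hyz' : y' + z' ≤ 1 := le_of_forall_pos_le_add fun ε hε =>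
    le_of_tendsto (hyt.add hzt) ((hyz ε hε).filter_mono hU)
  have hPA : P' ≤ A := le_of_forall_pos_le_add fun ε hε =>
    le_of_tendsto hPt ((hP ε hε).filter_mono hU)
  have hθ1' : 0 < 1 - θ := by linarith
  have ha1 : a ≤ P' * (x' ^ θ * y' ^ (1 - θ)) := le_of_forall_pos_sub_le fun ε hε =>
    ge_of_tendsto (hPt.mul ((hxt.rpow_const (Or.inr hθ0.le)).mul
      (hyt.rpow_const (Or.inr hθ1'.le)))) ((h1 ε hε).filter_mono hU)
  have ha2 : A - a ≤ P' * ((1 - x') ^ θ * z' ^ (1 - θ)) := le_of_forall_pos_sub_le fun ε hε =>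
    ge_of_tendsto (hPt.mul (((hxt.const_sub 1).rpow_const (Or.inr hθ0.le)).mul
      (hzt.rpow_const (Or.inr hθ1'.le)))) ((h2 ε hε).filter_mono hU)
  have hx1 : 0 ≤ 1 - x' := by linarith [hx'.2]
  have g1 := Real.geom_mean_le_arith_mean2_weighted hθ0.le hθ1'.le hx'.1 hy'.1 (by ring)
  have g2 := Real.geom_mean_le_arith_mean2_weighted hθ0.le hθ1'.le hx1 hz'.1 (by ring)
  -- Adding the two weighted means gives at most θ + (1-θ)(y'+z') ≤ 1. The lower bounds, summing to
  -- A, force equality throughout, so y' = x' and z' = 1 - x'; then a ≤ A x' and A - a ≤ A (1 - x')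
  -- pin down x'.
  have hsum : x' ^ θ * y' ^ (1 - θ) + (1 - x') ^ θ * z' ^ (1 - θ) ≤ 1 := by nlinarith
  have hPA' : P' = A := by
    refine le_antisymm hPA ?_
    have := mul_le_mul_of_nonneg_left hsum hP'.1
    linarith
  rw [hPA'] at ha1 ha2 hPt
  have hsum1 : 1 ≤ x' ^ θ * y' ^ (1 - θ) + (1 - x') ^ θ * z' ^ (1 - θ) := by
    refine le_of_mul_le_mul_left ?_ hA
    linarith
  have hyz1 : (1 - θ) * (y' + z') ≤ 1 - θ := mul_le_of_le_one_right hθ1'.le hyz'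
  have e1 : x' ^ θ * y' ^ (1 - θ) = θ * x' + (1 - θ) * y' := le_antisymm g1 (by linarith)
  have e2 : (1 - x') ^ θ * z' ^ (1 - θ) = θ * (1 - x') + (1 - θ) * z' :=
    le_antisymm g2 (by linarith)
  have exy := eq_of_rpow_mul_rpow_eq hθ0 hθ1 hx'.1 hy'.1 e1
  have exz := eq_of_rpow_mul_rpow_eq hθ0 hθ1 hx1 hz'.1 e2
  rw [e1, ← exy] at ha1
  rw [e2, ← exz] at ha2
  have hxa : x' = a / A := by
    rw [eq_div_iff hA.ne']
    linarith
  exact ⟨hxa ▸ hxt, hPt⟩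

/-! ### Asymptotically optimal sequences. -/

theorem exp_mul_renyiEntropy (r α : ℝ) (μ : Measure ℝ) (q : ℝ → ℝ) :
    EReal.exp ((r : EReal) * renyiEntropy α μ q) = cellSum α μ q Set.univ ^ (r / (1 - α)) := by
  rw [renyiEntropy_eq, ← mul_assoc, ← EReal.coe_mul, ← ENNReal.rpow_eq_exp_mul_log, mul_one_div]

theorem IsProbDensity.isProbabilityMeasure {g : ℝ → ℝ} (hg : IsProbDensity g) :
    IsProbabilityMeasure (densMeasure g) :=
  ⟨by rw [densMeasure_apply, setLIntegral_univ, hg.lintegral_eq_one]⟩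

/-- In [0, ∞] the degenerate quotients take the values 0 and ∞ only, so they cannot occur near the
limit 1. -/
theorem eventually_of_tendsto_div_one {D O : ℕ → ℝ≥0∞}
    (h : Tendsto (fun n => D n / O n) atTop (𝓝 1)) :
    (∀ᶠ n in atTop, O n ≠ 0 ∧ D n ≠ 0 ∧ D n ≠ ⊤) ∧
      ∀ ρ : ℝ≥0∞, 1 < ρ → ∀ᶠ n in atTop, D n ≤ ρ * O n := by
  have hpos := h.eventually_const_lt (u := 0) one_pos
  have hfin := h.eventually_lt_const (u := ⊤) ENNReal.one_lt_top
  have h1 : ∀ᶠ n in atTop, O n ≠ 0 ∧ D n ≠ 0 ∧ D n ≠ ⊤ ∧ O n ≠ ⊤ := by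
    filter_upwards [hpos, hfin] with n hp hf
    rw [ENNReal.div_pos_iff] at hp
    refine ⟨fun h0 => ?_, hp.1, fun h0 => ?_, hp.2⟩
    · rw [h0, ENNReal.div_zero hp.1] at hf
      exact hf.ne rfl
    · rw [h0, ENNReal.top_div_of_ne_top hp.2] at hf
      exact hf.ne rfl
  refine ⟨h1.mono fun n hn => ⟨hn.1, hn.2.1, hn.2.2.1⟩, fun ρ hρ => ?_⟩
  filter_upwards [h1, h.eventually_lt_const hρ] with n hn hlt
  exact (ENNReal.div_le_iff hn.1 hn.2.2.2).1 hlt.le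

section Asymptotics

variable {α r : ℝ} {g : ℝ → ℝ} {q : ℕ → ℝ → ℝ}

theorem IsAsymptoticallyOptimal.tendsto_cellSum (hα₁ : α < 1) {μ : Measure ℝ}
    (hq : IsAsymptoticallyOptimal α r μ q) :
    Tendsto (fun n => cellSum α μ (q n) Set.univ) atTop (𝓝 ⊤) := by
  have hα : 0 < 1 - α := by linarith
  have h1 := EReal.tendsto_exp_nhds_top_nhds_top.comp hq.tendsto_entropy
  have h2 := ((ENNReal.continuous_rpow_const (y := 1 - α)).tendsto ⊤).comp h1
  rw [ENNReal.top_rpow_of_pos hα] at h2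
  refine h2.congr fun n => ?_
  have := exp_mul_renyiEntropy 1 α μ (q n)
  rw [EReal.coe_one, one_mul] at this
  simp only [Function.comp_apply, this]
  rw [← ENNReal.rpow_mul, one_div_mul_cancel hα.ne', ENNReal.rpow_one]

theorem IsAsymptoticallyOptimal.eventually_finite (hr : 1 < r) (hα₀ : 0 < α) (hα₁ : α < 1)
    (hg : IsWeaklyUnimodal g)
    (hmoment : ∃ δ : ℝ, 0 < δ ∧ ∫⁻ x, ENNReal.ofReal (|x| ^ (r + δ)) ∂(densMeasure g) < ⊤)
    (hq : IsAsymptoticallyOptimal α r (densMeasure g) q) :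
    ∀ᶠ n in atTop, distortion r (densMeasure g) (q n) ≠ 0 ∧
      distortion r (densMeasure g) (q n) ≠ ⊤ ∧
      cellSum α (densMeasure g) (q n) Set.univ ≠ ⊤ := by
  obtain ⟨C, hC, hgC⟩ := hg.exists_decay hr hmoment
  have hA := lintegral_rpow_beta₁_lt_top hr hα₀ hα₁ hg.nonneg hC hgC
  filter_upwards [(eventually_of_tendsto_div_one hq.tendsto_ratio).1] with n hn
  refine ⟨hn.2.1, hn.2.2, fun hS => hn.1 ?_⟩
  refine optDistortion_eq_zero_of_cellSum_eq_top hr hα₀ hα₁ hg.toIsProbDensity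
    hg.upperSemicontinuous hC hgC (A := (∫⁻ x, ENNReal.ofReal (g x ^ beta₁ α r)).toReal + 1) ?_ hS
  rw [← ENNReal.ofReal_toReal hA.ne]
  refine (ENNReal.ofReal_lt_ofReal_iff (by positivity)).2 ?_
  rw [ENNReal.toReal_ofReal ENNReal.toReal_nonneg]
  linarith

theorem IsAsymptoticallyOptimal.eventually_holder_le (hr : 1 < r) (hα₀ : 0 < α) (hα₁ : α < 1)
    (hg : IsWeaklyUnimodal g)
    (hmoment : ∃ δ : ℝ, 0 < δ ∧ ∫⁻ x, ENNReal.ofReal (|x| ^ (r + δ)) ∂(densMeasure g) < ⊤)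
    (hq : IsAsymptoticallyOptimal α r (densMeasure g) q) {ε : ℝ} (hε : 0 < ε) :
    ∀ᶠ n in atTop, ((distortion r (densMeasure g) (q n)).toReal / constC r) ^ theta α r *
      (cellSum α (densMeasure g) (q n) Set.univ).toReal ^ (1 - theta α r) ≤
        (∫⁻ x, ENNReal.ofReal (g x ^ beta₁ α r)).toReal + ε := by
  obtain ⟨C, hC, hgC⟩ := hg.exists_decay hr hmoment
  have hA := lintegral_rpow_beta₁_lt_top hr hα₀ hα₁ hg.nonneg hC hgC
  have hCr := constC_pos hr
  have hθ := theta_pos hr hα₁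
  have hθ1 := theta_lt_one hr hα₁
  have hα : 0 < 1 - α := by linarith
  set A := (∫⁻ x, ENNReal.ofReal (g x ^ beta₁ α r)).toReal with hAdef
  have hA0 : 0 ≤ A := ENNReal.toReal_nonneg
  have hA' : ∫⁻ x, ENNReal.ofReal (g x ^ beta₁ α r) < ENNReal.ofReal (A + ε / 2) := by
    rw [← ENNReal.ofReal_toReal hA.ne]
    exact (ENNReal.ofReal_lt_ofReal_iff (by positivity)).2 (by linarith)
  have hB0 : 0 < A + ε / 2 := by positivity
  obtain ⟨s₀, hs₀, H⟩ := exists_optDistortion_le hr hα₀ hα₁ hg.toIsProbDensity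
    hg.upperSemicontinuous hC hgC hB0 hA'
  set B := A + ε / 2 with hB
  -- One half of ε is spent on the majorant and the rest on the ratio: the final bound is ρ^θ B ≤ ρ
  -- B = A + ε.
  set ρ := (A + ε) / B with hρ
  have hρ1 : 1 < ρ := by
    rw [hρ, one_lt_div hB0]
    linarith
  have hratio := (eventually_of_tendsto_div_one hq.tendsto_ratio).2 (ENNReal.ofReal ρ)
    (by rw [← ENNReal.ofReal_one]; exact (ENNReal.ofReal_lt_ofReal_iff (by linarith)).2 hρ1)
  filter_upwards [hq.eventually_finite hr hα₀ hα₁ hg hmoment, hratio,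
    (hq.tendsto_cellSum hα₁).eventually_const_lt (ENNReal.ofReal_lt_top (r := s₀))] with n hn hD hS
  set s := (cellSum α (densMeasure g) (q n) Set.univ).toReal with hs
  have hSs : cellSum α (densMeasure g) (q n) Set.univ = ENNReal.ofReal s :=
    (ENNReal.ofReal_toReal hn.2.2).symm
  have hss : s₀ < s := by
    rw [hSs] at hS
    exact (ENNReal.ofReal_lt_ofReal_iff_of_nonneg hs₀.le).1 hS
  have hs0 : 0 < s := hs₀.trans hss
  have hle : (distortion r (densMeasure g) (q n)).toReal ≤
      ρ * (constC r * B * (B / s) ^ (r / (1 - α))) := by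
    refine ENNReal.toReal_le_of_le_ofReal (by positivity) (hD.trans ?_)
    rw [ENNReal.ofReal_mul (by linarith)]
    gcongr
    exact H _ s hss hSs
  have hexp : r / (1 - α) * theta α r = 1 - theta α r := by
    rw [one_sub_theta hr hα₁, theta]
    field_simp
  calc _ ≤ (ρ * (B * (B / s) ^ (r / (1 - α)))) ^ theta α r * s ^ (1 - theta α r) := by
        gcongr
        rw [div_le_iff₀ hCr]
        linarith
    _ = ρ ^ theta α r * B := by
        rw [Real.mul_rpow (by linarith) (by positivity), Real.mul_rpow hB0.le (by positivity),
          ← Real.rpow_mul (by positivity), hexp, Real.div_rpow hB0.le hs0.le]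
        have e : B ^ theta α r * B ^ (1 - theta α r) = B := by
          rw [← Real.rpow_add hB0, add_sub_cancel, Real.rpow_one]
        have : s ^ (1 - theta α r) ≠ 0 := (Real.rpow_pos_of_pos hs0 _).ne'
        field_simp
        linear_combination e
    _ ≤ ρ ^ (1 : ℝ) * B := by
        gcongr
        exact hρ1.le
    _ = A + ε := by
        rw [Real.rpow_one, hρ, div_mul_cancel₀ _ hB0.ne']

theorem IsAsymptoticallyOptimal.tendsto_cellSum_toReal (hr : 1 < r) (hα₀ : 0 < α) (hα₁ : α < 1)
    (hg : IsWeaklyUnimodal g)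
    (hmoment : ∃ δ : ℝ, 0 < δ ∧ ∫⁻ x, ENNReal.ofReal (|x| ^ (r + δ)) ∂(densMeasure g) < ⊤)
    (hq : IsAsymptoticallyOptimal α r (densMeasure g) q) :
    Tendsto (fun n => (cellSum α (densMeasure g) (q n) Set.univ).toReal) atTop atTop := by
  refine tendsto_atTop.2 fun b => ?_
  filter_upwards [hq.eventually_finite hr hα₀ hα₁ hg hmoment,
    (hq.tendsto_cellSum hα₁).eventually_const_lt (ENNReal.ofReal_lt_top (r := b))] with n hn hS
  exact (ENNReal.ofReal_le_iff_le_toReal hn.2.2).1 hS.le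

/-- P stays bounded while S → ∞ with positive exponent 1-θ. This makes the lower bound, valid only
for small distortion, applicable. -/
theorem IsAsymptoticallyOptimal.tendsto_distortion_toReal (hr : 1 < r) (hα₀ : 0 < α)
    (hα₁ : α < 1) (hg : IsWeaklyUnimodal g)
    (hmoment : ∃ δ : ℝ, 0 < δ ∧ ∫⁻ x, ENNReal.ofReal (|x| ^ (r + δ)) ∂(densMeasure g) < ⊤)
    (hq : IsAsymptoticallyOptimal α r (densMeasure g) q) :
    Tendsto (fun n => (distortion r (densMeasure g) (q n)).toReal) atTop (𝓝 0) := by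
  have hCr := constC_pos hr
  have hθ := theta_pos hr hα₁
  have hθ1 := theta_lt_one hr hα₁
  set A := (∫⁻ x, ENNReal.ofReal (g x ^ beta₁ α r)).toReal
  have hS := hq.tendsto_cellSum_toReal hr hα₀ hα₁ hg hmoment
  have h1 : Tendsto (fun n =>
      ((distortion r (densMeasure g) (q n)).toReal / constC r) ^ theta α r) atTop (𝓝 0) := by
    have h2 := ((tendsto_rpow_neg_atTop (y := 1 - theta α r) (by linarith)).comp hS).const_mul
      (A + 1)
    rw [mul_zero] at h2
    refine tendsto_of_tendsto_of_tendsto_of_le_of_le' tendsto_const_nhds h2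
      (Eventually.of_forall fun n => by positivity) ?_
    filter_upwards [hq.eventually_holder_le hr hα₀ hα₁ hg hmoment one_pos,
      hS.eventually_gt_atTop 0] with n hn hs
    rw [Function.comp_apply, Real.rpow_neg hs.le, ← div_eq_mul_inv,
      le_div_iff₀ (Real.rpow_pos_of_pos hs _)]
    exact hn
  have h3 := (h1.rpow_const (p := 1 / theta α r) (Or.inr (by positivity))).const_mul (constC r)
  rw [Real.zero_rpow (by positivity), mul_zero] at h3
  refine h3.congr fun n => ?_
  rw [← Real.rpow_mul (by positivity), mul_one_div_cancel hθ.ne', Real.rpow_one]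
  field_simp

theorem distortionOn_add_compl (r : ℝ) (μ : Measure ℝ) (q : ℝ → ℝ) {E : Set ℝ}
    (hE : MeasurableSet E) :
    distortionOn r μ q E + distortionOn r μ q Eᶜ = distortion r μ q :=
  lintegral_add_compl _ hE

/-- For the sequence `q n`, the share of the distortion carried by a half line converges, and the
product `(D / C) ^ θ S ^ (1 - θ)` converges to the total mass of `g ^ β₁`. -/
theorem IsAsymptoticallyOptimal.tendsto_distortionOn_Iic (hr : 1 < r) (hα₀ : 0 < α) (hα₁ : α < 1)
    (hg : IsWeaklyUnimodal g)
    (hmoment : ∃ δ : ℝ, 0 < δ ∧ ∫⁻ x, ENNReal.ofReal (|x| ^ (r + δ)) ∂(densMeasure g) < ⊤)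
    (hq : IsAsymptoticallyOptimal α r (densMeasure g) q) (c : ℝ) :
    Tendsto (fun n => (distortionOn r (densMeasure g) (q n) (Set.Iic c)).toReal /
        (distortion r (densMeasure g) (q n)).toReal) atTop
      (𝓝 ((∫⁻ x in Set.Iic c, ENNReal.ofReal (g x ^ beta₁ α r)).toReal /
        (∫⁻ x, ENNReal.ofReal (g x ^ beta₁ α r)).toReal)) ∧
    Tendsto (fun n => ((distortion r (densMeasure g) (q n)).toReal / constC r) ^ theta α r *
      (cellSum α (densMeasure g) (q n) Set.univ).toReal ^ (1 - theta α r)) atTop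
      (𝓝 (∫⁻ x, ENNReal.ofReal (g x ^ beta₁ α r)).toReal) := by
  obtain ⟨C, hC, hgC⟩ := hg.exists_decay hr hmoment
  have hAfin := lintegral_rpow_beta₁_lt_top hr hα₀ hα₁ hg.nonneg hC hgC
  have hCr := constC_pos hr
  have hθ := theta_pos hr hα₁
  have hθ1 := theta_lt_one hr hα₁
  have := hg.isProbabilityMeasure
  set μ := densMeasure g
  set f : ℝ → ℝ≥0∞ := fun x => ENNReal.ofReal (g x ^ beta₁ α r)
  have hApos : 0 < (∫⁻ x, f x).toReal :=
    ENNReal.toReal_pos (hg.lintegral_rpow_pos _).ne' hAfin.ne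
  have hfinE : ∀ E : Set ℝ, ∫⁻ x in E, f x ≠ ⊤ := fun E =>
    ((setLIntegral_le_lintegral E f).trans_lt hAfin).ne
  have hsplit : (∫⁻ x in Set.Iic c, f x).toReal + (∫⁻ x in Set.Ioi c, f x).toReal =
      (∫⁻ x, f x).toReal := by
    rw [← ENNReal.toReal_add (hfinE _) (hfinE _), ← Set.compl_Iic,
      lintegral_add_compl f measurableSet_Iic]
  have hev := hq.eventually_finite hr hα₀ hα₁ hg hmoment
  have hSlim := hq.tendsto_cellSum_toReal hr hα₀ hα₁ hg hmoment
  have hcells : ∀ n, cellSum α μ (q n) (Set.Iic c) + cellSum α μ (q n) (Set.Ioi c) ≤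
      cellSum α μ (q n) Set.univ + 1 := fun n =>
    cellSum_Iic_add_cellSum_Ioi_le hα₀ μ (hq.isQuantizer n) c
  -- The local lower bound rewritten as P times a product of shares, the form used in the stability
  -- lemma. Finiteness of the cell sum matters because `toReal` sends ∞ to 0.
  have hlow : ∀ I : Set ℝ, MeasurableSet I → I.OrdConnected →
      (∀ n, cellSum α μ (q n) Set.univ ≠ ⊤ → cellSum α μ (q n) I ≠ ⊤) → ∀ ε, 0 < ε →
      ∀ᶠ n in atTop, (∫⁻ x in I, f x).toReal - ε ≤
        ((distortion r μ (q n)).toReal / constC r) ^ theta α r *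
        (cellSum α μ (q n) Set.univ).toReal ^ (1 - theta α r) *
        (((distortionOn r μ (q n) I).toReal / (distortion r μ (q n)).toReal) ^ theta α r *
        ((cellSum α μ (q n) I).toReal / (cellSum α μ (q n) Set.univ).toReal) ^
          (1 - theta α r)) := by
    intro I hI hIo hItop ε hε
    rcases le_or_gt ((∫⁻ x in I, f x).toReal - ε) 0 with h0 | h0
    · exact Eventually.of_forall fun n => h0.trans (by positivity)
    have hlt : ENNReal.ofReal ((∫⁻ x in I, f x).toReal - ε) < ∫⁻ x in I, f x := by
      rw [ENNReal.ofReal_lt_iff_lt_toReal h0.le (hfinE I)]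
      linarith
    obtain ⟨η, hη, H⟩ := hg.exists_le_distortionOn_mul_cellSum hr hα₀ hα₁ hI hIo hlt
    filter_upwards [hev, (hq.tendsto_distortion_toReal hr hα₀ hα₁ hg hmoment).eventually_lt_const hη,
      hSlim.eventually_gt_atTop 0] with n hn hnη hs
    have h1 := H (q n) (hq.isQuantizer n)
      ((ENNReal.lt_ofReal_iff_toReal_lt hn.2.1).2 hnη)
    have hDI : distortionOn r μ (q n) I ≠ ⊤ :=
      ((setLIntegral_le_lintegral I _).trans_lt (lt_top_iff_ne_top.2 hn.2.1)).ne
    have hd : 0 < (distortion r μ (q n)).toReal := ENNReal.toReal_pos hn.1 hn.2.1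
    have h2 : (∫⁻ x in I, f x).toReal - ε ≤
        ((distortionOn r μ (q n) I).toReal / constC r) ^ theta α r *
          (cellSum α μ (q n) I).toReal ^ (1 - theta α r) := by
      have hne : (distortionOn r μ (q n) I / ENNReal.ofReal (constC r)) ^ theta α r *
          cellSum α μ (q n) I ^ (1 - theta α r) ≠ ⊤ :=
        ENNReal.mul_ne_top (ENNReal.rpow_ne_top_of_nonneg hθ.le
          (ENNReal.div_ne_top hDI (by simpa using hCr)))
          (ENNReal.rpow_ne_top_of_nonneg (by linarith) (hItop n hn.2.2))
      have h3 := (ENNReal.ofReal_le_iff_le_toReal hne).1 h1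
      rwa [ENNReal.toReal_mul, ← ENNReal.toReal_rpow, ← ENNReal.toReal_rpow, ENNReal.toReal_div,
        ENNReal.toReal_ofReal hCr.le] at h3
    refine h2.trans (le_of_eq ?_)
    rw [mul_mul_mul_comm, ← Real.mul_rpow (by positivity) (by positivity),
      ← Real.mul_rpow (by positivity) (by positivity), mul_div_cancel₀ _ hs.ne']
    congr 2
    field_simp
  have hI1 : ∀ n, cellSum α μ (q n) Set.univ ≠ ⊤ → cellSum α μ (q n) (Set.Iic c) ≠ ⊤ :=
    fun n hn => ((le_self_add.trans (hcells n)).trans_lt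
      (lt_top_iff_ne_top.2 (ENNReal.add_ne_top.2 ⟨hn, ENNReal.one_ne_top⟩))).ne
  have hI2 : ∀ n, cellSum α μ (q n) Set.univ ≠ ⊤ → cellSum α μ (q n) (Set.Ioi c) ≠ ⊤ :=
    fun n hn => ((le_add_self.trans (hcells n)).trans_lt
      (lt_top_iff_ne_top.2 (ENNReal.add_ne_top.2 ⟨hn, ENNReal.one_ne_top⟩))).ne
  have hDsplit : ∀ᶠ n in atTop, 1 - (distortionOn r μ (q n) (Set.Iic c)).toReal /
        (distortion r μ (q n)).toReal =
      (distortionOn r μ (q n) (Set.Ioi c)).toReal / (distortion r μ (q n)).toReal := by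
    filter_upwards [hev] with n hn
    have hd : 0 < (distortion r μ (q n)).toReal := ENNReal.toReal_pos hn.1 hn.2.1
    have h1 := distortionOn_add_compl r μ (q n) (measurableSet_Iic (a := c))
    rw [Set.compl_Iic] at h1
    have h2 := ENNReal.add_ne_top.1 (h1 ▸ hn.2.1)
    rw [eq_div_iff hd.ne', sub_mul, div_mul_cancel₀ _ hd.ne', one_mul]
    conv_lhs => rw [← h1]
    rw [ENNReal.toReal_add h2.1 h2.2]
    ring
  refine tendsto_of_holder_eq (θ := theta α r)
    (y := fun n => (cellSum α μ (q n) (Set.Iic c)).toReal / (cellSum α μ (q n) Set.univ).toReal)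
    (z := fun n => (cellSum α μ (q n) (Set.Ioi c)).toReal / (cellSum α μ (q n) Set.univ).toReal)
    hθ hθ1 hApos ?_ (Eventually.of_forall fun n => by positivity)
    (Eventually.of_forall fun n => by positivity) (Eventually.of_forall fun n => by positivity)
    ?_ (fun ε hε => hq.eventually_holder_le hr hα₀ hα₁ hg hmoment hε)
    (hlow _ measurableSet_Iic Set.ordConnected_Iic hI1) ?_
  · filter_upwards [hDsplit] with n hn
    have : 0 ≤ (distortionOn r μ (q n) (Set.Ioi c)).toReal / (distortion r μ (q n)).toReal := by
      positivity
    exact ⟨by positivity, by linarith⟩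
  · intro ε hε
    filter_upwards [hev, hSlim.eventually_gt_atTop 0, hSlim.eventually_gt_atTop (1 / ε)]
      with n hn hs hsε
    have h1 := ENNReal.toReal_mono (ENNReal.add_ne_top.2 ⟨hn.2.2, ENNReal.one_ne_top⟩) (hcells n)
    rw [ENNReal.toReal_add (hI1 n hn.2.2) (hI2 n hn.2.2),
      ENNReal.toReal_add hn.2.2 ENNReal.one_ne_top, ENNReal.toReal_one] at h1
    rw [← add_div, div_le_iff₀ hs]
    rw [div_lt_iff₀ hε] at hsε
    linarith
  · intro ε hε
    filter_upwards [hDsplit, hlow _ measurableSet_Ioi Set.ordConnected_Ioi hI2 ε hε] with n h1 h2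
    rw [h1]
    linarith

end Asymptotics

/-! ### Weak convergence of the distortion measures. -/

/-- The normalized distortion measure `E ↦ ∫_E |x - q(x)| ^ r dμ / ∫ |x - q(x)| ^ r dμ`. -/
noncomputable def normDistortion (r : ℝ) (μ : Measure ℝ) (q : ℝ → ℝ) : Measure ℝ :=
  (distortion r μ q)⁻¹ • μ.withDensity fun x => ENNReal.ofReal (|x - q x| ^ r)

section Limit

variable {α r : ℝ} {g : ℝ → ℝ} {q : ℕ → ℝ → ℝ}

theorem normDistortion_apply (r : ℝ) (μ : Measure ℝ) (q : ℝ → ℝ) {E : Set ℝ}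
    (hE : MeasurableSet E) :
    normDistortion r μ q E = distortionOn r μ q E / distortion r μ q := by
  rw [normDistortion, Measure.smul_apply, withDensity_apply _ hE, smul_eq_mul, mul_comm,
    ← div_eq_mul_inv, distortionOn]

theorem isProbabilityMeasure_normDistortion {μ : Measure ℝ} {q : ℝ → ℝ}
    (h0 : distortion r μ q ≠ 0) (h1 : distortion r μ q ≠ ⊤) :
    IsProbabilityMeasure (normDistortion r μ q) :=
  ⟨by rw [normDistortion_apply _ _ _ MeasurableSet.univ, distortionOn, setLIntegral_univ]
      exact ENNReal.div_self h0 h1⟩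

theorem muHat_apply (g : ℝ → ℝ) (E : Set ℝ) :
    muHat α r g E = (∫⁻ x in E, ENNReal.ofReal (g x ^ beta₁ α r)) /
      ∫⁻ x, ENNReal.ofReal (g x ^ beta₁ α r) := by
  rw [muHat, Measure.smul_apply, powMeasure, withDensity_apply' _ E, smul_eq_mul, mul_comm,
    ← div_eq_mul_inv]

theorem limitMeasure_eq (hr : 1 < r) (hα₀ : 0 < α) (hα₁ : α < 1) (hg : IsWeaklyUnimodal g)
    (hmoment : ∃ δ : ℝ, 0 < δ ∧ ∫⁻ x, ENNReal.ofReal (|x| ^ (r + δ)) ∂(densMeasure g) < ⊤) :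
    limitMeasure α r g = (ENNReal.ofReal (constC r) *
        (∫⁻ x, ENNReal.ofReal (g x ^ beta₁ α r)) ^ (r / (1 - α)) *
        ∫⁻ x, ENNReal.ofReal (g x ^ beta₁ α r)) • muHat α r g := by
  obtain ⟨C, hC, hgC⟩ := hg.exists_decay hr hmoment
  rw [limitMeasure, muHat, smul_smul, mul_assoc _ _ (_⁻¹), ENNReal.mul_inv_cancel
    (hg.lintegral_rpow_pos _).ne' (lintegral_rpow_beta₁_lt_top hr hα₀ hα₁ hg.nonneg hC hgC).ne,
    mul_one]

theorem isProbabilityMeasure_muHat (hr : 1 < r) (hα₀ : 0 < α) (hα₁ : α < 1)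
    (hg : IsWeaklyUnimodal g)
    (hmoment : ∃ δ : ℝ, 0 < δ ∧ ∫⁻ x, ENNReal.ofReal (|x| ^ (r + δ)) ∂(densMeasure g) < ⊤) :
    IsProbabilityMeasure (muHat α r g) := by
  obtain ⟨C, hC, hgC⟩ := hg.exists_decay hr hmoment
  refine ⟨?_⟩
  rw [muHat_apply, setLIntegral_univ]
  exact ENNReal.div_self (hg.lintegral_rpow_pos _).ne'
    (lintegral_rpow_beta₁_lt_top hr hα₀ hα₁ hg.nonneg hC hgC).ne

variable (hr : 1 < r) (hα₀ : 0 < α) (hα₁ : α < 1) (hg : IsWeaklyUnimodal g)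
  (hmoment : ∃ δ : ℝ, 0 < δ ∧ ∫⁻ x, ENNReal.ofReal (|x| ^ (r + δ)) ∂(densMeasure g) < ⊤)
  (hq : IsAsymptoticallyOptimal α r (densMeasure g) q)

include hr hα₀ hα₁ hg hmoment hq

theorem tendsto_normDistortion_Iic (c : ℝ) :
    Tendsto (fun n => normDistortion r (densMeasure g) (q n) (Set.Iic c)) atTop
      (𝓝 (muHat α r g (Set.Iic c))) := by
  have := isProbabilityMeasure_muHat hr hα₀ hα₁ hg hmoment
  have h := ENNReal.tendsto_ofReal
    (hq.tendsto_distortionOn_Iic hr hα₀ hα₁ hg hmoment c).1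
  have hlim : ENNReal.ofReal ((∫⁻ x in Set.Iic c, ENNReal.ofReal (g x ^ beta₁ α r)).toReal /
      (∫⁻ x, ENNReal.ofReal (g x ^ beta₁ α r)).toReal) = muHat α r g (Set.Iic c) := by
    rw [← ENNReal.toReal_div, ← muHat_apply, ENNReal.ofReal_toReal (measure_ne_top _ _)]
  rw [hlim] at h
  refine h.congr' ?_
  filter_upwards [hq.eventually_finite hr hα₀ hα₁ hg hmoment] with n hn
  have := isProbabilityMeasure_normDistortion hn.1 hn.2.1
  rw [← ENNReal.toReal_div, ← normDistortion_apply _ _ _ measurableSet_Iic,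
    ENNReal.ofReal_toReal (measure_ne_top _ _)]

theorem tendsto_normDistortion_Ioc (c d : ℝ) :
    Tendsto (fun n => normDistortion r (densMeasure g) (q n) (Set.Ioc c d)) atTop
      (𝓝 (muHat α r g (Set.Ioc c d))) := by
  have := isProbabilityMeasure_muHat hr hα₀ hα₁ hg hmoment
  rcases le_or_gt d c with hdc | hcd
  · simp [Set.Ioc_eq_empty hdc.not_gt]
  have hdiff : ∀ (ν : Measure ℝ) [IsProbabilityMeasure ν],
      ν (Set.Ioc c d) = ν (Set.Iic d) - ν (Set.Iic c) := by
    intro ν _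
    rw [← Set.Iic_sdiff_Iic, measure_sdiff (Set.Iic_subset_Iic.2 hcd.le)
      measurableSet_Iic.nullMeasurableSet (measure_ne_top _ _)]
  rw [hdiff (muHat α r g)]
  refine (ENNReal.Tendsto.sub (tendsto_normDistortion_Iic hr hα₀ hα₁ hg hmoment hq d)
    (tendsto_normDistortion_Iic hr hα₀ hα₁ hg hmoment hq c)
    (Or.inl (measure_ne_top _ _))).congr' ?_
  filter_upwards [hq.eventually_finite hr hα₀ hα₁ hg hmoment] with n hn
  have := isProbabilityMeasure_normDistortion hn.1 hn.2.1
  exact (hdiff _).symm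

theorem tendsto_integral_normDistortion (f : ℝ →ᵇ ℝ) :
    Tendsto (fun n => ∫ x, f x ∂(normDistortion r (densMeasure g) (q n))) atTop
      (𝓝 (∫ x, f x ∂(muHat α r g))) := by
  -- The normalized measures are known to be probabilities only eventually; shifting the sequence by
  -- N allows working in `ProbabilityMeasure ℝ`. There, convergence on the π-system of half-open
  -- intervals, which contains small neighbourhoods of every point, suffices.
  obtain ⟨N, hN⟩ := eventually_atTop.1 (hq.eventually_finite hr hα₀ hα₁ hg hmoment)
  have hprob : ∀ n, IsProbabilityMeasure (normDistortion r (densMeasure g) (q (n + N))) := fun n =>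
    isProbabilityMeasure_normDistortion (hN _ (Nat.le_add_left N n)).1
      (hN _ (Nat.le_add_left N n)).2.1
  let ν : ℕ → ProbabilityMeasure ℝ := fun n => ⟨_, hprob n⟩
  let L : ProbabilityMeasure ℝ := ⟨_, isProbabilityMeasure_muHat hr hα₀ hα₁ hg hmoment⟩
  have hconv : Tendsto ν atTop (𝓝 L) := by
    refine (isPiSystem_Ioc (id : ℝ → ℝ) id).tendsto_probabilityMeasure_of_tendsto_of_mem ?_ ?_ ?_
    · rintro _ ⟨c, d, -, rfl⟩
      exact measurableSet_Ioc
    · intro u hu x hx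
      obtain ⟨ε, hε, hball⟩ := Metric.isOpen_iff.1 hu x hx
      refine ⟨Set.Ioc (x - ε / 2) (x + ε / 2), ⟨_, _, by simp only [id]; linarith, rfl⟩,
        Ioc_mem_nhds (by linarith) (by linarith), fun y hy => hball ?_⟩
      rw [Metric.mem_ball, Real.dist_eq, abs_lt]
      constructor <;> linarith [hy.1, hy.2]
    · rintro _ ⟨c, d, -, rfl⟩
      have h1 := (tendsto_add_atTop_iff_nat N).2
        (tendsto_normDistortion_Ioc hr hα₀ hα₁ hg hmoment hq c d)
      rw [← ENNReal.tendsto_coe]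
      refine Tendsto.congr
        (fun n => (ProbabilityMeasure.ennreal_coeFn_eq_coeFn_toMeasure (ν n) _).symm) ?_
      rw [ProbabilityMeasure.ennreal_coeFn_eq_coeFn_toMeasure]
      exact h1
  exact (tendsto_add_atTop_iff_nat N).1
    (ProbabilityMeasure.tendsto_iff_forall_integral_tendsto.1 hconv f)

theorem tendsto_exp_mul_distortion :
    Tendsto (fun n => (EReal.exp ((r : EReal) * renyiEntropy α (densMeasure g) (q n)) *
        distortion r (densMeasure g) (q n)).toReal) atTop
      (𝓝 (ENNReal.ofReal (constC r) *
        (∫⁻ x, ENNReal.ofReal (g x ^ beta₁ α r)) ^ (r / (1 - α)) *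
        ∫⁻ x, ENNReal.ofReal (g x ^ beta₁ α r)).toReal) := by
  have hC := constC_pos hr
  have hθ := theta_pos hr hα₁
  have hα : 0 < 1 - α := by linarith
  -- The limit of P does not involve the cut point, so 0 is an arbitrary choice. Raising to the
  -- power 1/θ = r/(1-α) + 1 turns P into e^{rH} D / C.
  have h1 := (((hq.tendsto_distortionOn_Iic hr hα₀ hα₁ hg hmoment 0).2).rpow_const
    (p := 1 / theta α r) (Or.inr (by positivity))).const_mul (constC r)
  have hexp : (1 - theta α r) * (1 / theta α r) = r / (1 - α) := by
    rw [one_sub_theta hr hα₁, theta]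
    have : 1 - α + r ≠ 0 := by linarith
    field_simp
  have hexp' : 1 / theta α r = r / (1 - α) + 1 := by
    rw [theta]
    field_simp
    ring
  have hlim : (ENNReal.ofReal (constC r) *
        (∫⁻ x, ENNReal.ofReal (g x ^ beta₁ α r)) ^ (r / (1 - α)) *
        ∫⁻ x, ENNReal.ofReal (g x ^ beta₁ α r)).toReal = constC r *
        (∫⁻ x, ENNReal.ofReal (g x ^ beta₁ α r)).toReal ^ (1 / theta α r) := by
    rw [ENNReal.toReal_mul, ENNReal.toReal_mul, ENNReal.toReal_ofReal hC.le, ← ENNReal.toReal_rpow,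
      hexp', Real.rpow_add_one' ENNReal.toReal_nonneg (by positivity), mul_assoc]
  rw [hlim]
  refine h1.congr fun n => ?_
  rw [exp_mul_renyiEntropy, ENNReal.toReal_mul, ← ENNReal.toReal_rpow,
    Real.mul_rpow (by positivity) (by positivity), ← Real.rpow_mul (by positivity),
    ← Real.rpow_mul (by positivity), hexp, mul_one_div_cancel hθ.ne', Real.rpow_one]
  field_simp

omit hr hα₀ hα₁ hmoment hq in
theorem scaledDistortionMeasure_eq {p : ℝ → ℝ} (hp : IsQuantizer p)
    (h0 : distortion r (densMeasure g) p ≠ 0) (h1 : distortion r (densMeasure g) p ≠ ⊤) :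
    scaledDistortionMeasure α r g p =
      (EReal.exp ((r : EReal) * renyiEntropy α (densMeasure g) p) *
        distortion r (densMeasure g) p) • normDistortion r (densMeasure g) p := by
  have hm := hp.measurable
  have hgm := hg.measurable
  rw [normDistortion, smul_smul, mul_assoc, ENNReal.mul_inv_cancel h0 h1, mul_one,
    scaledDistortionMeasure, densMeasure, ← withDensity_mul _ (by fun_prop) (by fun_prop)]
  congr 2
  ext x
  rw [Pi.mul_apply, mul_comm, ENNReal.ofReal_mul (hg.nonneg x)]

end Limit

end RenyiQuantization

theorem corollary3p4 (r α : ℝ) (hr : 1 < r) (hα₀ : 0 < α) (hα₁ : α < 1)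
    (g : ℝ → ℝ) (hg : RenyiQuantization.IsWeaklyUnimodal g)
    (hmoment : ∃ δ : ℝ, 0 < δ ∧
      ∫⁻ x, ENNReal.ofReal (|x| ^ (r + δ)) ∂(RenyiQuantization.densMeasure g) < ⊤)
    (q : ℕ → ℝ → ℝ)
    (hq : RenyiQuantization.IsAsymptoticallyOptimal α r (RenyiQuantization.densMeasure g) q) :
    IsProbabilityMeasure (RenyiQuantization.muHat α r g) ∧
    (∀ c d : ℝ, c < d →
      Tendsto (fun n =>
          RenyiQuantization.distortionOn r (RenyiQuantization.densMeasure g) (q n) (Set.Ioc c d) /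
            RenyiQuantization.distortion r (RenyiQuantization.densMeasure g) (q n))
        atTop (𝓝 (RenyiQuantization.muHat α r g (Set.Ioc c d)))) ∧
    RenyiQuantization.ConvergesWeakly
      (fun n => RenyiQuantization.scaledDistortionMeasure α r g (q n))
      (RenyiQuantization.limitMeasure α r g) := by
  have hprob := RenyiQuantization.isProbabilityMeasure_muHat hr hα₀ hα₁ hg hmoment
  have hα : 0 < 1 - α := by linarith
  have hev := hq.eventually_finite hr hα₀ hα₁ hg hmoment
  refine ⟨hprob, fun c d _ => ?_, ?_, ?_, fun f => ?_⟩
  · refine (RenyiQuantization.tendsto_normDistortion_Ioc hr hα₀ hα₁ hg hmoment hq c d).congr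
      fun n => ?_
    rw [RenyiQuantization.normDistortion_apply _ _ _ measurableSet_Ioc]
  · obtain ⟨C, hC, hgC⟩ := hg.exists_decay hr hmoment
    have hA := RenyiQuantization.lintegral_rpow_beta₁_lt_top hr hα₀ hα₁ hg.nonneg hC hgC
    rw [RenyiQuantization.limitMeasure_eq hr hα₀ hα₁ hg hmoment]
    refine Measure.smul_finite _ (ENNReal.mul_ne_top (ENNReal.mul_ne_top ENNReal.ofReal_ne_top ?_)
      hA.ne)
    exact ENNReal.rpow_ne_top_of_nonneg (by positivity) hA.ne
  · filter_upwards [hev] with n hn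
    have := RenyiQuantization.isProbabilityMeasure_normDistortion hn.1 hn.2.1
    rw [RenyiQuantization.scaledDistortionMeasure_eq hg (hq.isQuantizer n) hn.1 hn.2.1,
      RenyiQuantization.exp_mul_renyiEntropy]
    exact Measure.smul_finite _ (ENNReal.mul_ne_top
      (ENNReal.rpow_ne_top_of_nonneg (by positivity) hn.2.2) hn.2.1)
  -- Each scaled measure is its total mass e^{rH} D times a probability measure, and the two factors
  -- converge separately.
  · rw [RenyiQuantization.limitMeasure_eq hr hα₀ hα₁ hg hmoment, integral_smul_measure]
    refine ((RenyiQuantization.tendsto_exp_mul_distortion hr hα₀ hα₁ hg hmoment hq).smul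
      (RenyiQuantization.tendsto_integral_normDistortion hr hα₀ hα₁ hg hmoment hq f)).congr' ?_
    filter_upwards [hev] with n hn
    rw [RenyiQuantization.scaledDistortionMeasure_eq hg (hq.isQuantizer n) hn.1 hn.2.1,
      integral_smul_measure]
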